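/- Let $\Gamma$ be an infinite monoid with left and right cancellation which admits an injective homomorphism into a group, and let $G\subset\Gamma$ be a finite generating system with $e\notin G$. Let $(\Gamma,G)$ be the colored Cayley graph: its edges are the pairs $(\alpha,\beta)$ with $\alpha^{-1}\beta\in G$ or $\beta^{-1}\alpha\in G$, colored by $\alpha^{-1}\beta\in G\cup G^{-1}$. For $n\ge 0$ let $\Gamma_n$ be the ball of all products of at most $n$ elements of $G$. Let $\mathrm{Conf}$ be the set of isomorphism classes of finite $(G\cup G^{-1})$-colored graphs of valency at most $\#(G\cup G^{-1})$, with disjoint union as product, and let $\mathbb R[[\mathrm{Conf}]]=\prod_{S\in\mathrm{Conf}}\mathbb R\cdot S$ be the completed configuration algebra with the topology of coefficientwise convergence. For a finite colored graph $T$ let $A(S,T)$ be the number of its full subgraphs in the class $S$, and put $\mathcal A(T)=\sum_S S\cdot A(S,T)$ and $\mathcal M(T)=\log\mathcal A(T)$. Let $\mathcal L_{\mathbb R}\subset\mathbb R[[\mathrm{Conf}]]$ be the space of Lie-like elements for the coproducts $\Phi_m$ given by the covering coefficients, and let $\mathcal L_{\mathbb R,\infty}\subset\mathcal L_{\mathbb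 R}$ be the kernel of the kabi map, that is, the set of $f=\sum_S S\cdot f_S\in\mathcal L_{\mathbb R}$ such that $\sum_{S}(-1)^{\#S-\#T}K(T,S)\,f_S=0$ for every connected $T$, where $S$ runs over the connected configurations and $K(T,S)$ is the number of full subgraphs of $S$ in the class $T$ to which every other vertex of $S$ is adjacent. Put $$\Omega(\Gamma,G)=\mathcal L_{\mathbb R,\infty}\cap\overline{\Big\{\tfrac{\mathcal M(\Gamma_n)}{\#\Gamma_n}\ \Big|\ n\ge 0\Big\}} .$$ The action $\tilde\tau_\Omega$ is the map $\Omega(\Gamma,G)\to\Omega(\Gamma,G)$ with the following property: whenever $n_1<n_2<\cdots$ and $\mathcal M(\Gamma_{n_m})/\#\Gamma_{n_m}$ converges to $\omega\in\Omega(\Gamma,G)$, the sequence $\mathcal M(\Gamma_{n_m-1})/\#\Gamma_{n_m-1}$ converges to $\tilde\tau_\Omega(\omega)$. We say that it is defined if such a map exists. Suppose that $\Omega(\Gamma,G)$ is finite. (1) If the action $\tilde\tau_\Omega$ is defined, then there is an integer $\tilde h>0$ such that: - $\Omega(\Gamma,G)$ is the set of accumulation points of the sequence $(\mathcal M(\Gamma_n)/\#\Gamma_n)_{n\ge0}$,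 and this sequence is finite rationally accumulating with respect to the standard partition $\mathcal U_{\tilde h}$ of $\mathbb Z_{\ge0}$ into the residue classes modulo $\tilde h$. That is, for any pairwise disjoint open neighborhoods $\mathcal V_\omega$ of the points $\omega\in\Omega(\Gamma,G)$, the sets $U_\omega=\{n\mid \mathcal M(\Gamma_n)/\#\Gamma_n\in\mathcal V_\omega\}$ are rational (each $\sum_{n\in U_\omega}t^n$ is the Taylor expansion at $0$ of a rational function), they form a partition of $\mathbb Z_{\ge0}$ up to a finite set, and $\tilde h$ is the smallest positive integer such that, up to a finite set, every residue class modulo $\tilde h$ is contained in one of the $U_\omega$; - $\tilde\tau_\Omega$ acts transitively on $\Omega(\Gamma,G)$, every point has minimal period $\tilde h$ under $\tilde\tau_\Omega$, and $\tilde\tau_\Omega$ is invertible. (2) If the proportion in $\Gamma_n$ of dead elements (elements $g$ such that $\ell_G(gx)\le\ell_G(g)$ for all $x\in G$, where $\ell_G$ is the length with respect to $G$) tends to $0$ as $n\to\infty$, then the action $\tilde\tau_\Omega$ is defined, and it is uniquely determined. -/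

import Mathlib

open Filter Topology

noncomputable section

namespace CayleyLimit

universe u v w

/-! ### Colored graphs

A color set is a type `C` with an involution, written `c ↦ c⁻¹`. -/

/-- A `C`-colored graph on the vertex set `V`, without loops, all of whose vertices have valency at
most `q`. The value `color v w = none` means that `(v, w)` is not an edge. -/
structure ColoredGraph (C : Type u) [InvolutiveInv C] (q : ℕ) (V : Type v) where
  color : V → V → Option C
  color_self : ∀ x, color x x = none
  color_swap : ∀ x y, color y x = (color x y).map (fun c => c⁻¹)
  valency : ∀ x, {y | color x y ≠ none}.encard ≤ q

namespace ColoredGraph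

variable {C : Type u} [InvolutiveInv C] {q : ℕ} {V : Type v} {W : Type w}

/-- The underlying graph. -/
def toSimpleGraph (X : ColoredGraph C q V) : SimpleGraph V where
  Adj x y := X.color x y ≠ none
  symm := ⟨fun x y h => by
    rw [X.color_swap x y]
    simpa using h⟩
  loopless := ⟨fun x h => h (X.color_self x)⟩

/-- The graph structure induced by an injection of vertex sets. -/
def comap (X : ColoredGraph C q V) (f : W ↪ V) : ColoredGraph C q W where
  color x y := X.color (f x) (f y)
  color_self x := X.color_self (f x)
  color_swap x y := X.color_swap (f x) (f y)
  valency x := by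
    refine le_trans ?_ (X.valency (f x))
    rw [← f.injective.encard_image]
    apply Set.encard_le_encard
    rintro _ ⟨y, hy, rfl⟩
    exact hy

/-- The full subgraph on a set of vertices. -/
def induce (X : ColoredGraph C q V) (s : Set V) : ColoredGraph C q s :=
  X.comap (Function.Embedding.subtype (fun x => x ∈ s))

/-- Isomorphism of colored graphs. -/
def IsIso (X : ColoredGraph C q V) (Y : ColoredGraph C q W) : Prop :=
  ∃ e : V ≃ W, ∀ x y, Y.color (e x) (e y) = X.color x y

/-- The disjoint union of two colored graphs. -/
def sum (X : ColoredGraph C q V) (Y : ColoredGraph C q W) : ColoredGraph C q (V ⊕ W) where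
  color
    | Sum.inl x, Sum.inl y => X.color x y
    | Sum.inr x, Sum.inr y => Y.color x y
    | _, _ => none
  color_self
    | Sum.inl x => X.color_self x
    | Sum.inr x => Y.color_self x
  color_swap
    | Sum.inl x, Sum.inl y => X.color_swap x y
    | Sum.inr x, Sum.inr y => Y.color_swap x y
    | Sum.inl _, Sum.inr _ => rfl
    | Sum.inr _, Sum.inl _ => rfl
  valency
    | Sum.inl x => by
        refine le_trans ?_ (X.valency x)
        rw [← (Sum.inl_injective (α := V) (β := W)).encard_image]
        apply Set.encard_le_encard
        rintro (y | y) hy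
        · exact ⟨y, hy, rfl⟩
        · exact absurd rfl hy
    | Sum.inr x => by
        refine le_trans ?_ (Y.valency x)
        rw [← (Sum.inr_injective (α := V) (β := W)).encard_image]
        apply Set.encard_le_encard
        rintro (y | y) hy
        · exact absurd rfl hy
        · exact ⟨y, hy, rfl⟩

end ColoredGraph

/-! ### Configurations -/

/-- Isomorphism of colored graphs whose vertex sets are the standard finite sets. -/
def finGraphSetoid (C : Type u) [InvolutiveInv C] (q : ℕ) :
    Setoid (Σ n : ℕ, ColoredGraph C q (Fin n)) where
  r X Y := X.2.IsIso Y.2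
  iseqv :=
    { refl := fun _ => ⟨Equiv.refl _, fun _ _ => rfl⟩
      symm := fun ⟨e, he⟩ => ⟨e.symm, fun x y => by
        rw [← he, Equiv.apply_symm_apply, Equiv.apply_symm_apply]⟩
      trans := fun ⟨e, he⟩ ⟨f, hf⟩ => ⟨e.trans f, fun x y => by
        rw [← he, ← hf, Equiv.trans_apply, Equiv.trans_apply]⟩ }

/-- Configurations: isomorphism classes of finite `C`-colored graphs of valency at most `q`. -/
def Conf (C : Type u) [InvolutiveInv C] (q : ℕ) : Type u :=
  Quotient (finGraphSetoid C q)

/-- The isomorphism class of a colored graph on a finite vertex set. -/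
def ColoredGraph.conf {C : Type u} [InvolutiveInv C] {q : ℕ} {V : Type v} [Finite V]
    (X : ColoredGraph C q V) : Conf C q :=
  Quotient.mk (finGraphSetoid C q)
    ⟨Nat.card V, X.comap (Finite.equivFin V).symm.toEmbedding⟩

namespace Conf

variable {C : Type u} [InvolutiveInv C] {q : ℕ}

/-- The number of vertices of a configuration. -/
def size (S : Conf C q) : ℕ := (Quotient.out S).1

/-- A graph representing a configuration. -/
def rep (S : Conf C q) : ColoredGraph C q (Fin S.size) := (Quotient.out S).2

/-- The class of the empty graph. -/
def empty : Conf C q :=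
  ColoredGraph.conf (V := Empty)
    { color := fun x _ => x.elim
      color_self := fun x => x.elim
      color_swap := fun x _ => x.elim
      valency := fun x => x.elim }

/-- The product of two configurations: the class of the disjoint union. -/
def mul (S T : Conf C q) : Conf C q := (S.rep.sum T.rep).conf

/-- Connected configurations; the empty configuration is not connected. -/
def IsConnected (S : Conf C q) : Prop := S.rep.toSimpleGraph.Connected

end Conf

/-- The growth coefficient `A(S, X)`: the number of full subgraphs of the graph `X` in the
class `S`. -/
def growthCoeff {C : Type u} [InvolutiveInv C] {q : ℕ} {V : Type v}
    (X : ColoredGraph C q V) (S : Conf C q) : ℕ :=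
  Nat.card {s : Finset V // (X.induce (s : Set V)).conf = S}

/-- The covering coefficient: the number of tuples of full subgraphs of a representative of `U`
which belong to the classes `S i` and together cover all vertices. -/
def coveringCoeff {C : Type u} [InvolutiveInv C] {q : ℕ} (U : Conf C q) {m : ℕ}
    (S : Fin m → Conf C q) : ℕ :=
  Nat.card {s : Fin m → Finset (Fin U.size) //
    (∀ i, (U.rep.induce (s i : Set (Fin U.size))).conf = S i) ∧ ∀ x, ∃ i, x ∈ s i}

/-- The kabi coefficient `K(S, U)`: the number of full subgraphs of a representative of `U` in the
class `S` such that every vertex outside the subgraph is joined by an edge to a vertex of it. -/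
def kabiCoeff {C : Type u} [InvolutiveInv C] {q : ℕ} (S U : Conf C q) : ℕ :=
  Nat.card {s : Finset (Fin U.size) //
    (U.rep.induce (s : Set (Fin U.size))).conf = S ∧
      ∀ x, x ∉ s → ∃ y ∈ s, U.rep.color x y ≠ none}

/-! ### The configuration algebra over the real numbers -/

/-- The completed configuration algebra `ℝ⟦Conf⟧ = ∏_{S ∈ Conf} ℝ · S`. The classical topology is the
product topology, that is, the topology of coefficientwise convergence. -/
abbrev ConfSeries (C : Type u) [InvolutiveInv C] (q : ℕ) : Type u := Conf C q → ℝ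

namespace ConfSeries

variable {C : Type u} [InvolutiveInv C] {q : ℕ}

open Classical in
/-- The unit `1 = [∅]`. -/
def unit : ConfSeries C q := fun S => if S = Conf.empty then 1 else 0

/-- The product, which extends the product of configurations. For a finite color set, a configuration
has only finitely many decompositions. -/
def conv (f g : ConfSeries C q) : ConfSeries C q := fun S =>
  ∑ᶠ p : {p : Conf C q × Conf C q // p.1.mul p.2 = S}, f p.1.1 * g p.1.2

/-- Powers for the product `conv`. -/
def npow (f : ConfSeries C q) : ℕ → ConfSeries C q
  | 0 => unit
  | n + 1 => conv (npow f n) f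

/-- The logarithm `log f = ∑_{n ≥ 1} (-1)^(n-1) / n • (f - 1)^n` of a series with constant term `1`.
The `n`-th power does not contribute to the coefficient at `S` when `n` exceeds the number of
vertices of `S`. -/
def log (f : ConfSeries C q) : ConfSeries C q := fun S =>
  ∑ n ∈ Finset.Icc 1 S.size, (-1 : ℝ) ^ (n - 1) / (n : ℝ) * npow (f - unit) n S

/-- The `m`-th coproduct. The `m`-fold completed tensor power of the configuration algebra is the
space of all functions of `m` configurations. -/
def coprod (m : ℕ) (f : ConfSeries C q) : (Fin m → Conf C q) → ℝ := fun S =>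
  ∑ᶠ U : Conf C q, (coveringCoeff U S : ℝ) * f U

open Classical in
/-- Lie-like elements: `Φ_m(f) = ∑_i 1 ⊗ ⋯ ⊗ f ⊗ ⋯ ⊗ 1` for all `m ≥ 0`, with `f` at the `i`-th
place. -/
def IsLieLike (f : ConfSeries C q) : Prop :=
  ∀ (m : ℕ) (S : Fin m → Conf C q),
    coprod m f S = ∑ i : Fin m, if ∀ j, j ≠ i → S j = Conf.empty then f (S i) else 0

/-- The coefficient at `𝓜(T)` of the image of a Lie-like element under the kabi map: an element
`∑_S φ(S) a_S`, where `a_S` is the coefficient at the connected configuration `S`, is sent to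
`∑_T 𝓜(T) ∑_S (-1)^(#T - #S) K(T, S) a_S`. -/
def kabiMap (f : ConfSeries C q) (T : Conf C q) : ℝ :=
  ∑ᶠ S : {S : Conf C q // S.IsConnected},
    (-1 : ℝ) ^ (T.size + S.1.size) * (kabiCoeff T S.1 : ℝ) * f S.1

/-- The space of Lie-like elements at infinity: the kernel of the kabi map on the space of Lie-like
elements. -/
def lieAtInfinity (C : Type u) [InvolutiveInv C] (q : ℕ) : Set (ConfSeries C q) :=
  {f | IsLieLike f ∧ ∀ T : Conf C q, T.IsConnected → kabiMap f T = 0}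

end ConfSeries

/-- The growth function `𝓐(X) = ∑_S S · A(S, X)` of a finite graph. -/
def growthFunction {C : Type u} [InvolutiveInv C] {q : ℕ} {V : Type v}
    (X : ColoredGraph C q V) : ConfSeries C q := fun S => (growthCoeff X S : ℝ)

/-- The logarithmic growth function `𝓜(X) = log 𝓐(X)`. -/
def logGrowthFunction {C : Type u} [InvolutiveInv C] {q : ℕ} {V : Type v}
    (X : ColoredGraph C q V) : ConfSeries C q := ConfSeries.log (growthFunction X)

/-! ### The colored Cayley graph of a cancellative monoid -/

/-- A finite generating system of a monoid which does not contain the unit element. -/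
structure GenSystem (Γ : Type u) [Monoid Γ] where
  carrier : Finset Γ
  one_notMem : (1 : Γ) ∉ carrier
  closure_eq_top : Submonoid.closure (carrier : Set Γ) = ⊤

section Cayley

variable {Γ : Type u} [CancelMonoid Γ] (G : GenSystem Γ)

theorem mul_eq_one_swap {a b : Γ} (h : a * b = 1) : b * a = 1 := by
  apply mul_left_cancel (a := a)
  rw [← mul_assoc, h, one_mul, mul_one]

/-- The formal inverse of `a` is identified with the generator `b` if `a * b = 1`. -/
def colorRel : (G.carrier ⊕ G.carrier) → (G.carrier ⊕ G.carrier) → Prop := fun x y =>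
  ∃ a b : G.carrier, (a : Γ) * b = 1 ∧ x = Sum.inr a ∧ y = Sum.inl b

/-- The color set `G ∪ G⁻¹`; the right summand consists of the formal inverses. -/
def CayleyColor : Type u := Quot (colorRel G)

theorem colorRel_swap (x y : G.carrier ⊕ G.carrier) (h : colorRel G x y) :
    Quot.mk (colorRel G) x.swap = Quot.mk (colorRel G) y.swap := by
  obtain ⟨a, b, hab, rfl, rfl⟩ := h
  exact (Quot.sound ⟨b, a, mul_eq_one_swap hab, rfl, rfl⟩).symm

instance : InvolutiveInv (CayleyColor G) where
  inv := Quot.lift (fun x => Quot.mk (colorRel G) x.swap) (colorRel_swap G)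
  inv_inv c := by
    induction c using Quot.ind with
    | mk x => exact congrArg (Quot.mk (colorRel G)) x.swap_swap

instance : Finite (CayleyColor G) := inferInstanceAs (Finite (Quot (colorRel G)))

/-- `x⁻¹ y` equals the color `c`: either `c` is a generator and `y = x c`, or `c = g⁻¹` and
`x = y g`. -/
def colorJoins (c : CayleyColor G) (x y : Γ) : Prop :=
  Quot.lift (fun s : G.carrier ⊕ G.carrier =>
      Sum.elim (fun g : G.carrier => y = x * g) (fun g : G.carrier => x = y * g) s)
    (by
      rintro _ _ ⟨a, b, hab, rfl, rfl⟩
      apply propext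
      constructor
      · rintro h
        change y = x * b
        rw [show x = y * a from h, mul_assoc, hab, mul_one]
      · rintro h
        change x = y * a
        rw [show y = x * b from h, mul_assoc, mul_eq_one_swap hab, mul_one]) c

theorem colorJoins_right_unique {c : CayleyColor G} {x y z : Γ} (hy : colorJoins G c x y)
    (hz : colorJoins G c x z) : y = z := by
  induction c using Quot.ind with
  | mk s =>
    rcases s with g | g
    · exact (show y = x * g from hy).trans (show z = x * g from hz).symm
    · exact mul_right_cancel ((show x = y * g from hy).symm.trans (show x = z * g from hz))

theorem colorJoins_color_unique {c d : CayleyColor G} {x y : Γ} (hc : colorJoins G c x y)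
    (hd : colorJoins G d x y) : c = d := by
  induction c using Quot.ind with
  | mk s =>
    induction d using Quot.ind with
    | mk t =>
      rcases s with g | g <;> rcases t with k | k
      · have h1 : y = x * g := hc
        have h2 : y = x * k := hd
        have : g = k := Subtype.ext (mul_left_cancel (h1.symm.trans h2))
        rw [this]
      · have h1 : y = x * g := hc
        have h2 : x = y * k := hd
        have h3 : (k : Γ) * g = 1 := by
          apply mul_left_cancel (a := y)
          rw [← mul_assoc, ← h2, ← h1, mul_one]
        exact (Quot.sound ⟨k, g, h3, rfl, rfl⟩).symm
      · have h1 : x = y * g := hc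
        have h2 : y = x * k := hd
        have h3 : (g : Γ) * k = 1 := by
          apply mul_left_cancel (a := y)
          rw [← mul_assoc, ← h1, ← h2, mul_one]
        exact Quot.sound ⟨g, k, h3, rfl, rfl⟩
      · have h1 : x = y * g := hc
        have h2 : x = y * k := hd
        have : g = k := Subtype.ext (mul_left_cancel (h1.symm.trans h2))
        rw [this]

theorem colorJoins_inv {c : CayleyColor G} {x y : Γ} (h : colorJoins G c x y) :
    colorJoins G c⁻¹ y x := by
  induction c using Quot.ind with
  | mk s => rcases s with g | g <;> exact h

theorem not_colorJoins_self (c : CayleyColor G) (x : Γ) : ¬ colorJoins G c x x := by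
  intro h
  induction c using Quot.ind with
  | mk s =>
    rcases s with g | g
    · have h1 : x = x * g := h
      have h2 : (g : Γ) = 1 := mul_left_cancel (a := x) (by rw [← h1, mul_one])
      exact G.one_notMem (h2 ▸ g.2)
    · have h1 : x = x * g := h
      have h2 : (g : Γ) = 1 := mul_left_cancel (a := x) (by rw [← h1, mul_one])
      exact G.one_notMem (h2 ▸ g.2)

open Classical in
/-- The color `x⁻¹ y` of the pair `(x, y)`, if this is an edge. -/
def cayleyColorFun (x y : Γ) : Option (CayleyColor G) :=
  if h : ∃ c, colorJoins G c x y then some h.choose else none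

theorem cayleyColorFun_eq_some {c : CayleyColor G} {x y : Γ} :
    cayleyColorFun G x y = some c ↔ colorJoins G c x y := by
  unfold cayleyColorFun
  constructor
  · intro h
    split_ifs at h with h'
    have h2 : h'.choose = c := Option.some.inj h
    exact h2 ▸ h'.choose_spec
  · intro h
    have h' : ∃ c, colorJoins G c x y := ⟨c, h⟩
    rw [dif_pos h']
    exact congrArg some (colorJoins_color_unique G h'.choose_spec h)

/-- The colored Cayley graph of a cancellative monoid: `(x, y)` is an edge if `x⁻¹ y` or `y⁻¹ x`
belongs to `G`, and its color is `x⁻¹ y`. The bound for the valency is the number of colors. -/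
def cayleyGraph : ColoredGraph (CayleyColor G) (Nat.card (CayleyColor G)) Γ where
  color := cayleyColorFun G
  color_self x := by
    rw [Option.eq_none_iff_forall_not_mem]
    intro c hc
    exact not_colorJoins_self G c x ((cayleyColorFun_eq_some G).1 hc)
  color_swap x y := by
    ext c
    rw [Option.map_eq_some_iff]
    constructor
    · intro h
      exact ⟨c⁻¹, (cayleyColorFun_eq_some G).2
        (colorJoins_inv G ((cayleyColorFun_eq_some G).1 h)), inv_inv c⟩
    · rintro ⟨d, hd, rfl⟩
      exact (cayleyColorFun_eq_some G).2 (colorJoins_inv G ((cayleyColorFun_eq_some G).1 hd))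
  valency x := by
    have hinj : Set.InjOn (cayleyColorFun G x) {y | cayleyColorFun G x y ≠ none} := by
      intro y hy z _ hyz
      obtain ⟨c, hc⟩ := Option.ne_none_iff_exists'.1 hy
      exact colorJoins_right_unique G ((cayleyColorFun_eq_some G).1 hc)
        ((cayleyColorFun_eq_some G).1 (hyz ▸ hc))
    rw [← hinj.encard_image, ← Set.ncard_univ,
      Set.Finite.cast_ncard_eq (Set.finite_univ (α := CayleyColor G)),
      ← (Option.some_injective (CayleyColor G)).encard_image Set.univ]
    apply Set.encard_le_encard
    rintro _ ⟨y, hy, rfl⟩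
    obtain ⟨c, hc⟩ := Option.ne_none_iff_exists'.1 hy
    exact ⟨c, Set.mem_univ c, hc.symm⟩

/-- The length of an element with respect to `G`; only positive words in `G` are admitted. -/
def length (x : Γ) : ℕ :=
  sInf {n | ∃ l : List Γ, l.length = n ∧ (∀ g ∈ l, g ∈ G.carrier) ∧ l.prod = x}

/-- The ball `Γ_n`. -/
def ball (n : ℕ) : Set Γ := {x | length G x ≤ n}

/-- The free energy `𝓜(Γ_n) / #Γ_n` of the ball of radius `n`. -/
def freeEnergy (n : ℕ) : ConfSeries (CayleyColor G) (Nat.card (CayleyColor G)) := fun S =>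
  logGrowthFunction ((cayleyGraph G).induce (ball G n)) S / ((ball G n).ncard : ℝ)

/-- The limit space `Ω(Γ, G)`: the Lie-like elements at infinity in the closure of the set of the free
energies of balls. -/
def Omega : Set (ConfSeries (CayleyColor G) (Nat.card (CayleyColor G))) :=
  ConfSeries.lieAtInfinity (CayleyColor G) (Nat.card (CayleyColor G)) ∩
    closure (Set.range (freeEnergy G))

/-- The self-map `τ` of `Ω(Γ, G)` is the shift: whenever the free energies of the balls `Γ_{n_m}`
converge to `ω ∈ Ω(Γ, G)`, those of the balls `Γ_{n_m - 1}` converge to `τ ω`. -/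
def IsShiftAction (τ : Omega G → Omega G) : Prop :=
  ∀ (ω : Omega G) (n : ℕ → ℕ), StrictMono n →
    Tendsto (fun m => freeEnergy G (n m)) atTop (𝓝 ω.1) →
      Tendsto (fun m => freeEnergy G (n m - 1)) atTop (𝓝 (τ ω).1)

/-- The dead elements of `Γ`. -/
def deadElements : Set Γ := {x | ∀ g ∈ G.carrier, length G (x * g) ≤ length G x}

/-- The proportion of dead elements in the ball of radius `n` tends to `0`. -/
def DeadElementsNegligible : Prop :=
  Tendsto (fun n => ((ball G n ∩ deadElements G).ncard : ℝ) / ((ball G n).ncard : ℝ))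
    atTop (𝓝 0)

end Cayley

/-- The monoid `Γ` has an injective homomorphism into a group. -/
def EmbedsInGroup (Γ : Type u) [Monoid Γ] : Prop :=
  ∃ (H : Type u) (_ : Group H) (f : Γ →* H), Function.Injective f

/-! ### Finite rational accumulation -/

open Classical in
/-- A set `U` of natural numbers is rational if `∑_{n ∈ U} t ^ n` is the Taylor expansion at `0` of a
rational function `p / q`. -/
def IsRationalSubset (U : Set ℕ) : Prop :=
  ∃ p q : Polynomial ℂ, q.coeff 0 ≠ 0 ∧
    (q : PowerSeries ℂ) * PowerSeries.mk (fun n => if n ∈ U then (1 : ℂ) else 0) =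
      (p : PowerSeries ℂ)

/-- A finite family of rational sets which, away from a finite set, is a partition of `ℕ`. -/
def IsFiniteRationalPartition {ι : Type u} (U : ι → Set ℕ) : Prop :=
  Finite ι ∧ (∀ a, IsRationalSubset (U a)) ∧
    ∃ D : Set ℕ, D.Finite ∧ Pairwise (fun a b => Disjoint (U a \ D) (U b \ D)) ∧
      ⋃ a, U a \ D = Dᶜ

/-- The partition of `ℕ` into the residue classes modulo `h > 0` is, away from a finite set, a
subdivision of the family `U`. -/
def IsPeriodOfPartition {ι : Type u} (U : ι → Set ℕ) (h : ℕ) : Prop :=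
  0 < h ∧ ∃ D : Set ℕ, D.Finite ∧ ∀ e : ZMod h, ∃ a, {n : ℕ | (n : ZMod h) = e} \ D ⊆ U a

/-- The sequence `X` accumulates finite rationally to the set `A`, with respect to the standard
partition of `ℕ` into the residue classes modulo `h` (`h` is the minimal period): `A` is the set of
accumulation points of `X`, it is finite, and for pairwise disjoint open neighborhoods `V a` of the
points `a ∈ A`, the sets `{n | X n ∈ V a}` are a finite rational partition of `ℕ` whose standard
subdivision is the partition into the residue classes modulo `h`. -/
def IsFiniteRationallyAccumulating {E : Type u} [TopologicalSpace E] (X : ℕ → E) (A : Set E)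
    (h : ℕ) : Prop :=
  A.Finite ∧ (∀ a, a ∈ A ↔ MapClusterPt a atTop X) ∧
    ∀ V : A → Set E, (∀ a, IsOpen (V a)) → (∀ a : A, (a : E) ∈ V a) →
      Pairwise (fun a b => Disjoint (V a) (V b)) →
        IsFiniteRationalPartition (fun a => {n | X n ∈ V a}) ∧
          IsLeast {k | IsPeriodOfPartition (fun a => {n | X n ∈ V a}) k} h

end CayleyLimit

end

noncomputable section

namespace CayleyLimit

universe u v w

/-! ### Isomorphism classes of colored graphs -/

namespace ColoredGraph

variable {C : Type u} [InvolutiveInv C] {q : ℕ} {V : Type v} {W : Type w}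

/-! The logarithm has a cluster expansion. Grade the monoid of configurations by the number of
vertices. The growth function of a graph that splits into two parts without edges between them is a
product, so 𝓜 is additive there. Expanding the logarithm writes 𝓜 as a sum over vertex subsets of
weights that depend only on the induced class, and additivity kills the weights of disconnected
subsets. By `logGrowth_eq_sum`, every coefficient of 𝓜 is therefore a finite universal linear
combination of the counts A(U, ·) of connected U, and these counts are the coefficients of 𝓜 at
connected classes. Bounded valency bounds A(U, Γ_n)/#Γ_n, so all free energies lie in a compact
product of intervals.

Ω is the set of accumulation points (`mem_Omega_iff`). The growth function is group-like, so 𝓜 is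
Lie-like, and this condition is closed. By inclusion-exclusion (`sum_kabi`) the kabi map counts
connected components. A ball is connected, so its free energy has kabi coefficient 1/#Γ_n at its own
class and 0 at all others: no free energy lies in the kernel, but every accumulation point does
because #Γ_n tends to infinity.

Part (1) is then topological dynamics (`finite_shift`). Near a finite set of accumulation points of
a relatively compact sequence, each late index n carries a label l(n), and the shift property forces
l(n) = τ(l(n+1)). Every label recurs, so τ is a single cycle, and the labels are eventually periodic
with exactly the length of that cycle.

For part (2), consider the copies of S in Γ_n whose right translates by G remain in Γ_n. The colors
make this condition visible inside the graph, so the normalized count is a continuous linear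
functional of the free energy (`innerCount`). Copies inside Γ_{n-1} qualify, and any other
qualifying copy contains a dead element of length n. When dead elements are negligible, A(S,
Γ_{n-1})/#Γ_n therefore converges to a function of the limit ω; dividing by the case of a single
point, #Γ_{n-1}/#Γ_n, gives the limit of the preceding free energies. -/

theorem ext_color {X Y : ColoredGraph C q V} (h : ∀ x y, X.color x y = Y.color x y) : X = Y := by
  cases X; cases Y
  congr
  funext x y
  exact h x y

theorem IsIso.symm {X : ColoredGraph C q V} {Y : ColoredGraph C q W} :
    X.IsIso Y → Y.IsIso X := fun ⟨e, he⟩ => ⟨e.symm, fun x y => by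
  rw [← he, Equiv.apply_symm_apply, Equiv.apply_symm_apply]⟩

theorem IsIso.trans {U : Type*} {X : ColoredGraph C q V} {Y : ColoredGraph C q W}
    {Z : ColoredGraph C q U} : X.IsIso Y → Y.IsIso Z → X.IsIso Z :=
  fun ⟨e, he⟩ ⟨f, hf⟩ => ⟨e.trans f, fun x y => by
    rw [← he, ← hf, Equiv.trans_apply, Equiv.trans_apply]⟩

theorem isIso_comap_equiv (X : ColoredGraph C q V) (e : W ≃ V) :
    (X.comap e.toEmbedding).IsIso X := ⟨e, fun _ _ => rfl⟩

theorem conf_eq_conf_iff [Finite V] [Finite W] {X : ColoredGraph C q V}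
    {Y : ColoredGraph C q W} : X.conf = Y.conf ↔ X.IsIso Y := by
  have hX := X.isIso_comap_equiv (Finite.equivFin V).symm
  have hY := Y.isIso_comap_equiv (Finite.equivFin W).symm
  exact ⟨fun h => hX.symm.trans (IsIso.trans (Quotient.exact h) hY),
    fun h => Quotient.sound (hX.trans (h.trans hY.symm))⟩

theorem conf_rep (S : Conf C q) : S.rep.conf = S := by
  refine Eq.trans (Quotient.sound ?_) (Quotient.out_eq S)
  exact S.rep.isIso_comap_equiv (Finite.equivFin (Fin S.size)).symm

theorem rep_conf_isIso [Finite V] (X : ColoredGraph C q V) : X.conf.rep.IsIso X :=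
  conf_eq_conf_iff.1 (conf_rep _)

theorem size_conf [Finite V] (X : ColoredGraph C q V) : X.conf.size = Nat.card V := by
  obtain ⟨e, -⟩ := X.rep_conf_isIso
  rw [← Nat.card_congr e, Nat.card_fin]

theorem IsIso.connected_iff {X : ColoredGraph C q V} {Y : ColoredGraph C q W} (h : X.IsIso Y) :
    X.toSimpleGraph.Connected ↔ Y.toSimpleGraph.Connected := by
  obtain ⟨e, he⟩ := h
  refine SimpleGraph.Iso.connected_iff ⟨e, ?_⟩
  intro a b
  change Y.color (e a) (e b) ≠ none ↔ X.color a b ≠ none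
  rw [he]

theorem isConnected_conf [Finite V] (X : ColoredGraph C q V) :
    X.conf.IsConnected ↔ X.toSimpleGraph.Connected :=
  X.rep_conf_isIso.connected_iff

theorem IsIso.sum {V' W' : Type*} {X : ColoredGraph C q V} {Y : ColoredGraph C q W}
    {X' : ColoredGraph C q V'} {Y' : ColoredGraph C q W'} :
    X.IsIso X' → Y.IsIso Y' → (X.sum Y).IsIso (X'.sum Y') :=
  fun ⟨e, he⟩ ⟨f, hf⟩ => ⟨Equiv.sumCongr e f, by
    rintro (x | x) (y | y)
    · exact he x y
    · rfl
    · rfl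
    · exact hf x y⟩

end ColoredGraph

open ColoredGraph

/-! ### The commutative monoid of configurations, graded by size -/

namespace Conf

variable {C : Type u} [InvolutiveInv C] {q : ℕ}

instance : One (Conf C q) := ⟨Conf.empty⟩

instance : Mul (Conf C q) := ⟨Conf.mul⟩

theorem conf_mul_conf {V : Type v} {W : Type w} [Finite V] [Finite W] (X : ColoredGraph C q V)
    (Y : ColoredGraph C q W) : X.conf * Y.conf = (X.sum Y).conf :=
  conf_eq_conf_iff.2 (X.rep_conf_isIso.sum Y.rep_conf_isIso)

theorem conf_eq_one {V : Type v} [IsEmpty V] (X : ColoredGraph C q V) : X.conf = 1 :=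
  conf_eq_conf_iff.2 ⟨Equiv.equivOfIsEmpty _ _, fun x => isEmptyElim x⟩

instance : CommMonoid (Conf C q) where
  mul_assoc S T U := by
    rw [← conf_rep S, ← conf_rep T, ← conf_rep U, conf_mul_conf, conf_mul_conf, conf_mul_conf,
      conf_mul_conf, conf_eq_conf_iff]
    refine ⟨Equiv.sumAssoc _ _ _, ?_⟩
    rintro ((x | x) | x) ((y | y) | y) <;> rfl
  one_mul S := by
    have h : (1 : Conf C q) = _ := (conf_rep 1).symm
    have h0 : (1 : Conf C q).size = 0 := by
      change (ColoredGraph.conf _).size = 0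
      rw [size_conf]; simp
    have : IsEmpty (Fin (1 : Conf C q).size) := by rw [h0]; infer_instance
    rw [h, ← conf_rep S, conf_mul_conf, conf_eq_conf_iff]
    refine ⟨Equiv.emptySum _ _, ?_⟩
    rintro (x | x) (y | y)
    · exact isEmptyElim x
    · exact isEmptyElim x
    · exact isEmptyElim y
    · rfl
  mul_one S := by
    have h : (1 : Conf C q) = _ := (conf_rep 1).symm
    have h0 : (1 : Conf C q).size = 0 := by
      change (ColoredGraph.conf _).size = 0
      rw [size_conf]; simp
    have : IsEmpty (Fin (1 : Conf C q).size) := by rw [h0]; infer_instance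
    rw [h, ← conf_rep S, conf_mul_conf, conf_eq_conf_iff]
    refine ⟨Equiv.sumEmpty _ _, ?_⟩
    rintro (x | x) (y | y)
    · rfl
    · exact isEmptyElim y
    · exact isEmptyElim x
    · exact isEmptyElim x
  mul_comm S T := by
    rw [← conf_rep S, ← conf_rep T, conf_mul_conf, conf_mul_conf, conf_eq_conf_iff]
    refine ⟨Equiv.sumComm _ _, ?_⟩
    rintro (x | x) (y | y) <;> rfl

theorem size_mul (S T : Conf C q) : (S * T).size = S.size + T.size := by
  rw [← conf_rep S, ← conf_rep T, conf_mul_conf, size_conf, size_conf, size_conf, Nat.card_sum]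

theorem size_one : (1 : Conf C q).size = 0 := by
  change (ColoredGraph.conf _).size = 0
  rw [size_conf]; simp

theorem size_eq_zero_iff {S : Conf C q} : S.size = 0 ↔ S = 1 := by
  constructor
  · intro h
    have : IsEmpty (Fin S.size) := by rw [h]; infer_instance
    rw [← conf_rep S]
    exact conf_eq_one _
  · rintro rfl
    exact size_one

/-- The number of vertices as a homomorphism of monoids. -/
def sizeHom : Conf C q →* Multiplicative ℕ where
  toFun S := Multiplicative.ofAdd S.size
  map_one' := by rw [size_one]; rfl
  map_mul' S T := by rw [size_mul]; rfl

theorem IsConnected.size_pos {S : Conf C q} (h : S.IsConnected) : 0 < S.size := by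
  obtain ⟨x⟩ := SimpleGraph.Connected.nonempty h
  exact x.pos

theorem finite_coloredGraph [Finite C] (n : ℕ) : Finite (ColoredGraph C q (Fin n)) := by
  apply Finite.of_injective (fun X : ColoredGraph C q (Fin n) => X.color)
  intro X Y h
  exact ext_color fun x y => congrFun (congrFun h x) y

theorem finite_size_le [Finite C] (n : ℕ) : {S : Conf C q | S.size ≤ n}.Finite := by
  have : ∀ k, Finite (ColoredGraph C q (Fin k)) := finite_coloredGraph
  apply (Set.finite_range (fun X : Σ k : Fin (n + 1), ColoredGraph C q (Fin k) =>
    X.2.conf)).subset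
  intro S hS
  exact ⟨⟨⟨S.size, Nat.lt_succ_of_le hS⟩, S.rep⟩, conf_rep S⟩

instance [Finite C] : Countable (Conf C q) := by
  have : ∀ k, Finite (ColoredGraph C q (Fin k)) := finite_coloredGraph
  exact inferInstanceAs (Countable (Quotient (finGraphSetoid C q)))

end Conf

/-! ### Full subgraphs and their classes -/

namespace ColoredGraph

variable {C : Type u} [InvolutiveInv C] {q : ℕ} {V : Type v} {W : Type w}

/-- The configuration of the full subgraph on a finite set of vertices. -/
def subconf (X : ColoredGraph C q V) (s : Finset V) : Conf C q := (X.induce (s : Set V)).conf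

theorem size_subconf (X : ColoredGraph C q V) (s : Finset V) : (X.subconf s).size = s.card := by
  rw [subconf, size_conf]; simp

theorem subconf_eq_one_iff {X : ColoredGraph C q V} {s : Finset V} :
    X.subconf s = 1 ↔ s = ∅ := by
  rw [← Conf.size_eq_zero_iff, size_subconf, Finset.card_eq_zero]

theorem subconf_univ [Fintype V] (X : ColoredGraph C q V) :
    X.subconf Finset.univ = X.conf :=
  conf_eq_conf_iff.2 ⟨Equiv.subtypeUnivEquiv (by simp), fun _ _ => rfl⟩

theorem subconf_comap (X : ColoredGraph C q V) (f : W ↪ V) (s : Finset W) :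
    (X.comap f).subconf s = X.subconf (s.map f) := by
  refine conf_eq_conf_iff.2 ⟨(Equiv.Set.image f s f.injective).trans
    (Equiv.setCongr (by simp)), fun _ _ => rfl⟩

/-- The pullback equals the chosen representative on the nose. Counts defined on representatives are
thereby transferred to subsets of an ambient graph by their compatibility with `comap`. -/
theorem exists_embedding (X : ColoredGraph C q V) (u : Finset V) :
    ∃ f : Fin (X.subconf u).size ↪ V, Finset.univ.map f = u ∧
      X.comap f = (X.subconf u).rep := by
  obtain ⟨e, he⟩ : (X.subconf u).rep.IsIso (X.induce (u : Set V)) := rep_conf_isIso _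
  refine ⟨e.toEmbedding.trans (Function.Embedding.subtype _), ?_, ext_color he⟩
  ext x
  simp only [Finset.mem_map, Finset.mem_univ, true_and]
  constructor
  · rintro ⟨y, rfl⟩
    exact (e y).2
  · intro hx
    exact ⟨e.symm ⟨x, hx⟩, by simp⟩

theorem subconf_disjUnion [DecidableEq V] (X : ColoredGraph C q V) {s t : Finset V}
    (hd : Disjoint s t) (h : ∀ x ∈ s, ∀ y ∈ t, X.color x y = none) :
    X.subconf (s ∪ t) = X.subconf s * X.subconf t := by
  unfold subconf
  rw [Conf.conf_mul_conf]
  symm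
  rw [conf_eq_conf_iff]
  have hd' : Disjoint (s : Set V) (t : Set V) := by exact_mod_cast hd
  classical
  refine ⟨(Equiv.Set.union hd').symm.trans (Equiv.setCongr (by simp)), ?_⟩
  rintro (x | x) (y | y)
  · rfl
  · exact h x x.2 y y.2
  · change X.color x y = none
    rw [X.color_swap y x, h y y.2 x x.2]; rfl
  · rfl

theorem isConnected_subconf (X : ColoredGraph C q V) (s : Finset V) :
    (X.subconf s).IsConnected ↔ (X.induce (s : Set V)).toSimpleGraph.Connected :=
  isConnected_conf _

theorem growthCoeff_eq [Fintype V] [DecidableEq (Conf C q)] (X : ColoredGraph C q V)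
    (S : Conf C q) :
    growthCoeff X S = (Finset.univ.filter fun s : Finset V => X.subconf s = S).card := by
  unfold growthCoeff
  exact Nat.subtype_card _ fun s => by
    rw [Finset.mem_filter]
    exact and_iff_right (Finset.mem_univ s)

end ColoredGraph

/-! ### Logarithms in graded monoid algebras -/

section Logarithm

open PowerSeries in
-- Both sides have constant term zero, and their derivatives agree after multiplication by the unit
-- f g; torsion-freeness lets the derivative determine the series.
theorem logOf_mul {A : Type*} [CommRing A] [Algebra ℚ A] [IsAddTorsionFree A] {f g : PowerSeries A}
    (hf : constantCoeff f = 1) (hg : constantCoeff g = 1) :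
    logOf (f * g) = logOf f + logOf g := by
  have hsub : ∀ f : PowerSeries A, constantCoeff f = 1 → HasSubst (f - 1) := fun f hf =>
    HasSubst.of_constantCoeff_zero' (by simp [hf])
  -- Logarithmic differentiation: f (log f)' = f', obtained by substituting f - 1 into (1 + X) (log
  -- (1 + X))' = 1.
  have key : ∀ f : PowerSeries A, constantCoeff f = 1 →
      f * derivative A (logOf f) = derivative A f := by
    intro f hf
    have h1 : (1 + X) * derivative A (log A) = 1 := by
      rw [deriv_log]
      ext n
      rw [add_mul, one_mul, map_add]
      cases n with
      | zero => simp
      | succ n => rw [coeff_succ_X_mul, coeff_mk, coeff_mk, ← map_add, coeff_one]; simp [pow_succ]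
    have h2 := congrArg (fun h => h.subst (f - 1)) h1
    simp only [subst_mul (hsub f hf), subst_add (hsub f hf), subst_X (hsub f hf)] at h2
    have h3 : (1 : PowerSeries A).subst (f - 1) = (1 : PowerSeries A) := by
      rw [← coe_substAlgHom (hsub f hf), map_one]
    rw [h3, add_sub_cancel] at h2
    rw [logOf_eq, derivative_subst (hsub f hf), ← mul_assoc, h2, one_mul]
    simp
  have hfg : constantCoeff (f * g) = 1 := by rw [map_mul, hf, hg, one_mul]
  apply derivative.ext
  · have hu : IsUnit (f * g) := by
      rw [isUnit_iff_constantCoeff, hfg]; exact isUnit_one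
    apply hu.mul_left_cancel
    rw [key _ hfg, Derivation.leibniz, ← key f hf, ← key g hg, map_add]
    simp only [smul_eq_mul]
    ring
  · rw [map_add, constantCoeff_logOf hf, constantCoeff_logOf hg, constantCoeff_logOf hfg, add_zero]

open PowerSeries in
-- Only n ≤ N contributes because X divides f - 1.
theorem coeff_logOf {A : Type*} [CommRing A] [Algebra ℚ A] {f : PowerSeries A}
    (hf : constantCoeff f = 1) (N : ℕ) :
    coeff N (logOf f) =
      ∑ n ∈ Finset.Icc 1 N, ((-1 : ℚ) ^ (n - 1) / n) • coeff N ((f - 1) ^ n) := by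
  rw [logOf_eq, coeff_subst' (HasSubst.of_constantCoeff_zero' (by simp [hf])),
    finsum_eq_sum_of_support_subset (s := Finset.Icc 1 N)]
  · refine Finset.sum_congr rfl fun n hn => ?_
    have hn1 := (Finset.mem_Icc.1 hn).1
    rw [coeff_log, if_neg (by omega), algebraMap_smul]
    obtain ⟨k, rfl⟩ := Nat.exists_eq_add_of_le' hn1
    simp [pow_succ]
  · intro n hn
    rw [Function.mem_support] at hn
    rw [Finset.coe_Icc, Set.mem_Icc]
    constructor
    · by_contra h
      have : n = 0 := by omega
      subst this
      simp at hn
    · by_contra! h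
      apply hn
      have hd : (X : PowerSeries A) ^ n ∣ (f - 1) ^ n :=
        pow_dvd_pow_of_dvd (X_dvd_iff.2 (by simp [hf])) n
      rw [X_pow_dvd_iff.1 hd N h, smul_zero]

variable {P : Type u} [CommMonoid P] (wt : P →* Multiplicative ℕ)

/-- The coefficient at `p` of the logarithm, for an element of a monoid algebra which is `1` in
weight zero. -/
def logCoeff (a : MonoidAlgebra ℝ P) (p : P) : ℝ :=
  ∑ n ∈ Finset.Icc 1 (wt p).toAdd, (-1 : ℝ) ^ (n - 1) / (n : ℝ) * ((a - 1) ^ n).coeff p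

/-- A monoid element as a homogeneous power series. -/
def homogeneousSingle : P →* PowerSeries (MonoidAlgebra ℝ P) where
  toFun p := PowerSeries.monomial (wt p).toAdd (MonoidAlgebra.single p 1)
  map_one' := by
    rw [map_one, toAdd_one, ← MonoidAlgebra.one_def, PowerSeries.monomial_zero_eq_C_apply, map_one]
  map_mul' p r := by
    rw [PowerSeries.monomial_mul_monomial, map_mul, MonoidAlgebra.single_mul_single, one_mul,
      toAdd_mul]

/-- The homogenization of the elements of a graded monoid algebra. -/
def homogenize : MonoidAlgebra ℝ P →ₐ[ℝ] PowerSeries (MonoidAlgebra ℝ P) :=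
  MonoidAlgebra.lift ℝ _ P
    (homogeneousSingle wt)

open Classical in
theorem coeff_homogenize (a : MonoidAlgebra ℝ P) (N : ℕ) (p : P) :
    (PowerSeries.coeff N (homogenize wt a)).coeff p =
      if (wt p).toAdd = N then a.coeff p else 0 := by
  induction a using MonoidAlgebra.induction_linear with
  | zero => simp
  | add x y hx hy =>
    rw [map_add, map_add, MonoidAlgebra.coeff_add, Finsupp.add_apply, hx, hy,
      MonoidAlgebra.coeff_add, Finsupp.add_apply]
    split_ifs <;> simp
  | single r b =>
    rw [homogenize, MonoidAlgebra.lift_single]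
    have h1 : PowerSeries.coeff N (b • homogeneousSingle wt r) =
      b • PowerSeries.coeff N (PowerSeries.monomial (wt r).toAdd
        (MonoidAlgebra.single r (1 : ℝ))) :=
      rfl
    rw [h1, PowerSeries.coeff_monomial]
    by_cases h : r = p
    · subst h
      by_cases h' : (wt r).toAdd = N
      · simp [h']
      · rw [if_neg (Ne.symm h'), if_neg h']; simp
    · rw [MonoidAlgebra.coeff_single, Finsupp.single_apply, if_neg h]
      split_ifs <;> simp [h]

variable {wt}

theorem constantCoeff_homogenize {a : MonoidAlgebra ℝ P}
    (ha : ∀ p, (wt p).toAdd = 0 → (a - 1).coeff p = 0) :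
    PowerSeries.constantCoeff (homogenize wt a) = 1 := by
  have h : PowerSeries.constantCoeff (homogenize wt (a - 1)) = 0 := by
    rw [← PowerSeries.coeff_zero_eq_constantCoeff_apply]
    ext p
    rw [coeff_homogenize]
    split_ifs with h
    · exact ha p h
    · rfl
  rwa [map_sub, map_one, map_sub, map_one, sub_eq_zero] at h

/-- Replacing p by p t^(wt p) turns the weight truncation into an honest power series logarithm, so
that `logOf_mul` becomes available for elements of the monoid algebra. -/
theorem logCoeff_eq {a : MonoidAlgebra ℝ P}
    (ha : ∀ p, (wt p).toAdd = 0 → (a - 1).coeff p = 0) (p : P) :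
    logCoeff wt a p =
      (PowerSeries.coeff (wt p).toAdd (PowerSeries.logOf (homogenize wt a))).coeff p := by
  rw [coeff_logOf (A := MonoidAlgebra ℝ P) (constantCoeff_homogenize ha),
    MonoidAlgebra.coeff_sum, Finsupp.finsetSum_apply, logCoeff]
  refine Finset.sum_congr rfl fun n _ => ?_
  rw [MonoidAlgebra.coeff_smul_apply, ← map_one (homogenize wt), ← map_sub, ← map_pow,
    coeff_homogenize, if_pos rfl, Rat.smul_def]
  push_cast
  rfl

theorem unipotent_mul {a b : MonoidAlgebra ℝ P}
    (ha : ∀ p, (wt p).toAdd = 0 → (a - 1).coeff p = 0)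
    (hb : ∀ p, (wt p).toAdd = 0 → (b - 1).coeff p = 0) (p : P) (hp : (wt p).toAdd = 0) :
    (a * b - 1).coeff p = 0 := by
  have h : PowerSeries.constantCoeff (homogenize wt (a * b - 1)) = 0 := by
    simp [constantCoeff_homogenize ha, constantCoeff_homogenize hb]
  rw [← PowerSeries.coeff_zero_eq_constantCoeff_apply] at h
  have h2 := coeff_homogenize wt (a * b - 1) 0 p
  rw [if_pos hp, h] at h2
  exact h2.symm

theorem logCoeff_mul {a b : MonoidAlgebra ℝ P}
    (ha : ∀ p, (wt p).toAdd = 0 → (a - 1).coeff p = 0)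
    (hb : ∀ p, (wt p).toAdd = 0 → (b - 1).coeff p = 0) (p : P) :
    logCoeff wt (a * b) p = logCoeff wt a p + logCoeff wt b p := by
  have : IsAddTorsionFree (MonoidAlgebra ℝ P) := IsAddTorsionFree.of_module_rat _
  rw [logCoeff_eq ha, logCoeff_eq hb, logCoeff_eq (unipotent_mul ha hb), map_mul,
    logOf_mul (A := MonoidAlgebra ℝ P) (constantCoeff_homogenize ha)
      (constantCoeff_homogenize hb), map_add,
    MonoidAlgebra.coeff_add, Finsupp.add_apply]

/-- The powers of an element without constant term vanish in small weights. -/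
theorem coeff_pow_eq_zero {a : MonoidAlgebra ℝ P}
    (ha : ∀ p, (wt p).toAdd = 0 → (a - 1).coeff p = 0) {n : ℕ} {p : P} (h : (wt p).toAdd < n) :
    ((a - 1) ^ n).coeff p = 0 := by
  have hd : (PowerSeries.X : PowerSeries (MonoidAlgebra ℝ P)) ^ n ∣
      homogenize wt (a - 1) ^ n :=
    pow_dvd_pow_of_dvd (PowerSeries.X_dvd_iff.2 (by
      rw [map_sub, map_one, map_sub, map_one, constantCoeff_homogenize ha, sub_self])) n
  have h1 := PowerSeries.X_pow_dvd_iff.1 hd _ h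
  have h2 := coeff_homogenize wt ((a - 1) ^ n) (wt p).toAdd p
  rw [if_pos rfl, map_pow, h1] at h2
  exact h2.symm

/-- Allows one common truncation for coefficients of different weights, which is needed when the
coproduct mixes them. -/
theorem logCoeff_eq_sum {a : MonoidAlgebra ℝ P}
    (ha : ∀ p, (wt p).toAdd = 0 → (a - 1).coeff p = 0) {p : P} {N : ℕ} (h : (wt p).toAdd ≤ N) :
    logCoeff wt a p =
      ∑ n ∈ Finset.Icc 1 N, (-1 : ℝ) ^ (n - 1) / (n : ℝ) * ((a - 1) ^ n).coeff p := by
  refine Finset.sum_subset (Finset.Icc_subset_Icc_right h) fun n hn hn' => ?_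
  rw [coeff_pow_eq_zero ha, mul_zero]
  simp only [Finset.mem_Icc] at hn hn'
  omega

end Logarithm

open scoped Classical
open ColoredGraph Conf

/-! ### Growth functions and the cluster expansion of their logarithms -/

section GrowthElement

variable {C : Type u} [InvolutiveInv C] {q : ℕ} {V : Type v} {W : Type w}

theorem powerset_map (f : W ↪ V) (w : Finset W) :
    (w.map f).powerset = w.powerset.map (Finset.mapEmbedding f).toEmbedding := by
  ext s
  simp only [Finset.mem_powerset, Finset.subset_map_iff, Finset.mem_map,
    RelEmbedding.coe_toEmbedding, Finset.mapEmbedding_apply]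
  exact ⟨fun ⟨u, h1, h2⟩ => ⟨u, h1, h2.symm⟩, fun ⟨u, h1, h2⟩ => ⟨u, h1, h2.symm⟩⟩

/-- The number of subsets of `w` which induce a full subgraph in the class `S`. -/
def subCount (X : ColoredGraph C q V) (w : Finset V) (S : Conf C q) : ℕ :=
  (w.powerset.filter fun s => X.subconf s = S).card

theorem growthCoeff_eq_subCount [Fintype V] (X : ColoredGraph C q V) (S : Conf C q) :
    growthCoeff X S = subCount X Finset.univ S := by
  rw [growthCoeff_eq, subCount, Finset.powerset_univ]

/-- The growth function of the full subgraph on `w`, as an element of the monoid algebra. -/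
def growthElement (X : ColoredGraph C q V) (w : Finset V) : MonoidAlgebra ℝ (Conf C q) :=
  ∑ s ∈ w.powerset, MonoidAlgebra.single (X.subconf s) 1

theorem coeff_growthElement (X : ColoredGraph C q V) (w : Finset V) (S : Conf C q) :
    (growthElement X w).coeff S = subCount X w S := by
  rw [growthElement, MonoidAlgebra.coeff_sum, Finsupp.finsetSum_apply, subCount,
    Finset.card_filter]
  push_cast
  simp [Finsupp.single_apply]

theorem growthElement_comap (X : ColoredGraph C q V) (f : W ↪ V) (w : Finset W) :
    growthElement (X.comap f) w = growthElement X (w.map f) := by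
  unfold growthElement
  rw [powerset_map, Finset.sum_map]
  simp only [subconf_comap]
  rfl

theorem growthElement_sub_one (X : ColoredGraph C q V) (w : Finset V) :
    growthElement X w - 1 =
      ∑ s ∈ w.powerset.filter Finset.Nonempty, MonoidAlgebra.single (X.subconf s) 1 := by
  have h : w.powerset.filter Finset.Nonempty = w.powerset.erase ∅ := by
    ext s
    simp [Finset.nonempty_iff_ne_empty, and_comm]
  rw [h, growthElement, ← Finset.add_sum_erase _ _ (Finset.empty_mem_powerset w),
    subconf_eq_one_iff.2 rfl, MonoidAlgebra.one_def, add_sub_cancel_left]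

theorem growthElement_unipotent (X : ColoredGraph C q V) (w : Finset V) (S : Conf C q)
    (h : (sizeHom S).toAdd = 0) : (growthElement X w - 1).coeff S = 0 := by
  have hS : S = 1 := size_eq_zero_iff.1 h
  rw [growthElement_sub_one, MonoidAlgebra.coeff_sum, Finsupp.finsetSum_apply]
  refine Finset.sum_eq_zero fun s hs => ?_
  rw [MonoidAlgebra.coeff_single, Finsupp.single_apply, if_neg]
  rw [hS, subconf_eq_one_iff]
  exact (Finset.mem_filter.1 hs).2.ne_empty

/-- A subset of s ∪ t is a pair of subsets of s and t, and since no edge joins the two its class is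
the product of the two classes. -/
theorem growthElement_union (X : ColoredGraph C q V) {s t : Finset V} (hd : Disjoint s t)
    (h : ∀ x ∈ s, ∀ y ∈ t, X.color x y = none) :
    growthElement X (s ∪ t) = growthElement X s * growthElement X t := by
  unfold growthElement
  rw [Finset.sum_mul_sum, ← Finset.sum_product']
  symm
  refine Finset.sum_nbij' (fun p => p.1 ∪ p.2) (fun u => (u ∩ s, u ∩ t)) ?_ ?_ ?_ ?_ ?_
  · intro p hp
    simp only [Finset.mem_product, Finset.mem_powerset] at hp ⊢
    exact Finset.union_subset_union hp.1 hp.2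
  · intro u hu
    simp only [Finset.mem_product, Finset.mem_powerset]
    exact ⟨Finset.inter_subset_right, Finset.inter_subset_right⟩
  · rintro ⟨a, b⟩ hp
    simp only [Finset.mem_product, Finset.mem_powerset] at hp
    have h1 : Disjoint b s := hd.symm.mono_left hp.2
    have h2 : Disjoint a t := hd.mono_left hp.1
    simp only [Prod.mk.injEq, Finset.union_inter_distrib_right]
    rw [Finset.disjoint_iff_inter_eq_empty.1 h1, Finset.disjoint_iff_inter_eq_empty.1 h2,
      Finset.inter_eq_left.2 hp.1, Finset.inter_eq_left.2 hp.2]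
    simp
  · intro u hu
    rw [Finset.mem_powerset] at hu
    simp only
    rw [← Finset.inter_union_distrib_left, Finset.inter_eq_left.2 hu]
  · rintro ⟨a, b⟩ hp
    simp only [Finset.mem_product, Finset.mem_powerset] at hp
    simp only
    rw [MonoidAlgebra.single_mul_single, mul_one, X.subconf_disjUnion (hd.mono hp.1 hp.2)
      fun x hx y hy => h x (hp.1 hx) y (hp.2 hy)]

/-- The coefficient at `S` of the logarithmic growth function of the full subgraph on `w`. -/
def logGrowth (X : ColoredGraph C q V) (w : Finset V) (S : Conf C q) : ℝ :=
  logCoeff sizeHom (growthElement X w) S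

theorem logGrowth_union (X : ColoredGraph C q V) {s t : Finset V} (hd : Disjoint s t)
    (h : ∀ x ∈ s, ∀ y ∈ t, X.color x y = none) (S : Conf C q) :
    logGrowth X (s ∪ t) S = logGrowth X s S + logGrowth X t S := by
  rw [logGrowth, growthElement_union X hd h,
    logCoeff_mul (growthElement_unipotent X s) (growthElement_unipotent X t)]
  rfl

theorem npow_growthFunction [Finite C] [Fintype V] (X : ColoredGraph C q V) (n : ℕ)
    (S : Conf C q) :
    ConfSeries.npow (growthFunction X - ConfSeries.unit) n S =
      ((growthElement X Finset.univ - 1) ^ n).coeff S := by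
  have hone : ∀ S : Conf C q, (1 : MonoidAlgebra ℝ (Conf C q)).coeff S = ConfSeries.unit S := by
    intro S
    rw [MonoidAlgebra.one_def, MonoidAlgebra.coeff_single, Finsupp.single_apply]
    unfold ConfSeries.unit
    exact if_congr eq_comm rfl rfl
  induction n generalizing S with
  | zero => rw [pow_zero, hone]; rfl
  | succ n ih =>
    -- Sizes add under the product, so S has finitely many factorizations and the `finsum` in `conv`
    -- is a genuine sum.
    have hfin : {p : Conf C q × Conf C q | p.1.mul p.2 = S}.Finite := by
      apply ((finite_size_le S.size).prod (finite_size_le S.size)).subset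
      rintro ⟨a, b⟩ hp
      have h : a * b = S := hp
      have := size_mul a b
      rw [h] at this
      simp only [Set.mem_prod, Set.mem_ofPred_eq]
      omega
    rw [pow_succ, MonoidAlgebra.coeff_mul_antidiag _ _ S hfin.toFinset
      (by intro p; rw [Set.Finite.mem_toFinset]; rfl)]
    change (∑ᶠ p : {p : Conf C q × Conf C q | p.1.mul p.2 = S}, _) = _
    rw [finsum_set_coe_eq_finsum_mem (f := fun p : Conf C q × Conf C q =>
      ConfSeries.npow (growthFunction X - ConfSeries.unit) n p.1 *
        (growthFunction X - ConfSeries.unit : ConfSeries C q) p.2),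
      finsum_mem_eq_finite_toFinset_sum _ hfin]
    refine Finset.sum_congr rfl fun p _ => ?_
    rw [ih, Pi.sub_apply, MonoidAlgebra.coeff_sub, Finsupp.sub_apply, hone, coeff_growthElement,
      growthFunction, growthCoeff_eq_subCount]

theorem logGrowthFunction_eq [Finite C] [Fintype V] (X : ColoredGraph C q V) (S : Conf C q) :
    logGrowthFunction X S = logGrowth X Finset.univ S := by
  unfold logGrowthFunction ConfSeries.log
  simp only [npow_growthFunction]
  rfl

/-- The `n`-tuples of nonempty subsets of `u` which cover `u` and induce full subgraphs whose
disjoint union is in the class `S`. -/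
def coveringTuples (X : ColoredGraph C q V) (n : ℕ) (u : Finset V) (S : Conf C q) :
    Finset (Fin n → Finset V) :=
  (Fintype.piFinset fun _ : Fin n => u.powerset.filter Finset.Nonempty).filter
    fun s => ∏ i, X.subconf (s i) = S ∧ ∀ x ∈ u, ∃ i, x ∈ s i

theorem card_coveringTuples_comap (X : ColoredGraph C q V) (f : W ↪ V) (n : ℕ) (w : Finset W)
    (S : Conf C q) :
    (coveringTuples (X.comap f) n w S).card = (coveringTuples X n (w.map f) S).card := by
  refine Finset.card_nbij (fun s i => (s i).map f) ?_ ?_ ?_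
  · intro s hs
    simp only [coveringTuples, Finset.mem_filter, Fintype.mem_piFinset, Finset.mem_powerset,
      Finset.coe_filter, Set.mem_ofPred_eq, subconf_comap, Finset.map_subset_map,
      Finset.map_nonempty, Finset.mem_map] at hs ⊢
    refine ⟨hs.1, hs.2.1, ?_⟩
    rintro _ ⟨x, hx, rfl⟩
    obtain ⟨i, hi⟩ := hs.2.2 x hx
    exact ⟨i, x, hi, rfl⟩
  · intro s _ t _ hst
    funext i
    exact Finset.map_injective f (congrFun hst i)
  · intro s hs
    simp only [coveringTuples, Finset.coe_filter, Set.mem_ofPred_eq, Finset.mem_filter,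
      Fintype.mem_piFinset, Finset.mem_powerset, Finset.mem_map] at hs
    have h : ∀ i, ∃ u ⊆ w, s i = u.map f := fun i => Finset.subset_map_iff.1 (hs.1 i).1
    choose t ht hst using h
    refine ⟨t, ?_, funext fun i => (hst i).symm⟩
    simp only [coveringTuples, Finset.coe_filter, Set.mem_ofPred_eq, Finset.mem_filter,
      Fintype.mem_piFinset, Finset.mem_powerset, subconf_comap]
    simp only [hst, Finset.map_nonempty] at hs
    refine ⟨fun i => ⟨ht i, (hs.1 i).2⟩, hs.2.1, fun x hx => ?_⟩
    obtain ⟨i, hi⟩ := hs.2.2 (f x) ⟨x, hx, rfl⟩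
    exact ⟨i, (Finset.mem_map' f).1 hi⟩

/-- The sizes of the members add up to the size of S, and a cover needs total size at least that of
u. -/
theorem coveringTuples_eq_empty (X : ColoredGraph C q V) {n : ℕ} {u : Finset V} {S : Conf C q}
    (h : S.size < u.card) : coveringTuples X n u S = ∅ := by
  rw [Finset.eq_empty_iff_forall_notMem]
  intro s hs
  simp only [coveringTuples, Finset.mem_filter] at hs
  have h1 : u ⊆ Finset.univ.biUnion s := by
    intro x hx
    obtain ⟨i, hi⟩ := hs.2.2 x hx
    exact Finset.mem_biUnion.2 ⟨i, Finset.mem_univ i, hi⟩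
  have h2 : S.size = ∑ i, (s i).card := by
    have : sizeHom S = ∏ i, sizeHom (X.subconf (s i)) := by rw [← map_prod, hs.2.1]
    have h3 := congrArg Multiplicative.toAdd this
    rw [toAdd_prod] at h3
    refine h3.trans (Finset.sum_congr rfl fun i _ => size_subconf X (s i))
  have h4 := (Finset.card_le_card h1).trans Finset.card_biUnion_le
  omega

theorem coeff_growthElement_pow (X : ColoredGraph C q V) (n : ℕ) (w : Finset V) (S : Conf C q) :
    ((growthElement X w - 1) ^ n).coeff S =
      ∑ u ∈ w.powerset, ((coveringTuples X n u S).card : ℝ) := by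
  have h1 : ((growthElement X w - 1) ^ n).coeff S =
      ((Fintype.piFinset fun _ : Fin n => w.powerset.filter Finset.Nonempty).filter
        fun s => ∏ i, X.subconf (s i) = S).card := by
    rw [growthElement_sub_one, Finset.sum_pow', MonoidAlgebra.coeff_sum, Finsupp.finsetSum_apply,
      Finset.card_filter]
    push_cast
    refine Finset.sum_congr rfl fun s _ => ?_
    have : ∏ i, MonoidAlgebra.single (X.subconf (s i)) (1 : ℝ) =
        MonoidAlgebra.single (∏ i, X.subconf (s i)) 1 :=
      (map_prod (MonoidAlgebra.of ℝ (Conf C q)) _ _).symm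
    rw [this, MonoidAlgebra.coeff_single, Finsupp.single_apply]
  -- Tuples are grouped according to their union u, which they then cover.
  rw [h1, Finset.card_eq_sum_card_fiberwise (f := fun s => Finset.univ.biUnion s)
    (t := w.powerset)]
  · push_cast
    refine Finset.sum_congr rfl fun u hu => ?_
    congr 2
    ext s
    simp only [coveringTuples, Finset.mem_filter, Fintype.mem_piFinset, Finset.mem_powerset] at hu ⊢
    constructor
    · rintro ⟨⟨hs, hS⟩, rfl⟩
      refine ⟨fun i => ⟨Finset.subset_biUnion_of_mem s (Finset.mem_univ i), (hs i).2⟩, hS,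
        fun x hx => by simpa using hx⟩
    · rintro ⟨hs, hS, hc⟩
      refine ⟨⟨fun i => ⟨(hs i).1.trans hu, (hs i).2⟩, hS⟩, ?_⟩
      apply Finset.Subset.antisymm
      · exact Finset.biUnion_subset.2 fun i _ => (hs i).1
      · intro x hx
        simpa using hc x hx
  · intro s hs
    simp only [Finset.coe_filter, Set.mem_ofPred_eq, Fintype.mem_piFinset, Finset.mem_filter,
      Finset.mem_powerset] at hs
    simp only [Finset.coe_powerset, Set.mem_preimage, Set.mem_powerset_iff]
    exact_mod_cast Finset.biUnion_subset.2 fun i _ => (hs.1 i).1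

/-- The contribution of the subset `u` to the coefficient at `S` of the logarithmic growth
function. -/
def clusterWeight (X : ColoredGraph C q V) (u : Finset V) (S : Conf C q) : ℝ :=
  ∑ n ∈ Finset.Icc 1 S.size, (-1 : ℝ) ^ (n - 1) / (n : ℝ) * ((coveringTuples X n u S).card : ℝ)

theorem logGrowth_eq_sum_clusterWeight (X : ColoredGraph C q V) (w : Finset V) (S : Conf C q) :
    logGrowth X w S = ∑ u ∈ w.powerset, clusterWeight X u S := by
  unfold logGrowth logCoeff clusterWeight
  rw [Finset.sum_comm]
  refine Finset.sum_congr rfl fun n _ => ?_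
  rw [coeff_growthElement_pow, Finset.mul_sum]

theorem clusterWeight_comap (X : ColoredGraph C q V) (f : W ↪ V) (w : Finset W) (S : Conf C q) :
    clusterWeight (X.comap f) w S = clusterWeight X (w.map f) S := by
  unfold clusterWeight
  simp only [card_coveringTuples_comap]

theorem clusterWeight_of_size_lt (X : ColoredGraph C q V) {u : Finset V} {S : Conf C q}
    (h : S.size < u.card) : clusterWeight X u S = 0 := by
  unfold clusterWeight
  simp [coveringTuples_eq_empty X h]

theorem clusterWeight_empty (X : ColoredGraph C q V) (S : Conf C q) :
    clusterWeight X ∅ S = 0 := by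
  refine Finset.sum_eq_zero fun n hn => ?_
  have : coveringTuples X n ∅ S = ∅ := by
    rw [Finset.eq_empty_iff_forall_notMem]
    intro s hs
    simp only [coveringTuples, Finset.mem_filter, Fintype.mem_piFinset, Finset.mem_powerset,
      Finset.subset_empty] at hs
    have h := hs.1 ⟨0, (Finset.mem_Icc.1 hn).1⟩
    exact h.2.ne_empty h.1
  rw [this]; simp

/-- Additivity of the logarithm says that the weights of all subsets of s ∪ t sum to those of the
subsets of s plus those of the subsets of t. By strong induction every proper subset meeting both
parts has weight zero, so the only term left over, that of s ∪ t, vanishes too. -/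
theorem clusterWeight_union (X : ColoredGraph C q V) (S : Conf C q) (u : Finset V) :
    ∀ s t : Finset V, s.Nonempty → t.Nonempty → Disjoint s t →
      (∀ x ∈ s, ∀ y ∈ t, X.color x y = none) → u = s ∪ t → clusterWeight X u S = 0 := by
  induction u using Finset.strongInduction with
  | H u ih =>
    rintro s t hs ht hd h rfl
    have h1 := logGrowth_union X hd h S
    simp only [logGrowth_eq_sum_clusterWeight] at h1
    rw [← Finset.add_sum_erase _ _ (Finset.mem_powerset_self (s ∪ t))] at h1
    have h2 : s.powerset ∪ t.powerset ⊆ (s ∪ t).powerset.erase (s ∪ t) := by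
      intro r hr
      rw [Finset.mem_union, Finset.mem_powerset, Finset.mem_powerset] at hr
      rw [Finset.mem_erase, Finset.mem_powerset]
      rcases hr with hr | hr
      · refine ⟨?_, hr.trans Finset.subset_union_left⟩
        rintro rfl
        obtain ⟨y, hy⟩ := ht
        exact Finset.disjoint_left.1 hd (hr (Finset.mem_union_right _ hy)) hy
      · refine ⟨?_, hr.trans Finset.subset_union_right⟩
        rintro rfl
        obtain ⟨y, hy⟩ := hs
        exact Finset.disjoint_left.1 hd hy (hr (Finset.mem_union_left _ hy))
    rw [← Finset.sum_subset h2] at h1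
    · have h3 := Finset.sum_union_inter (s₁ := s.powerset) (s₂ := t.powerset)
        (f := fun r => clusterWeight X r S)
      have h4 : s.powerset ∩ t.powerset = {∅} := by
        ext r
        simp only [Finset.mem_inter, Finset.mem_powerset, Finset.mem_singleton]
        constructor
        · rintro ⟨ha, hb⟩
          have h5 := Finset.subset_inter ha hb
          rwa [Finset.disjoint_iff_inter_eq_empty.1 hd, Finset.subset_empty] at h5
        · rintro rfl
          simp
      rw [h4, Finset.sum_singleton, clusterWeight_empty, add_zero] at h3
      rw [h3] at h1
      linarith
    -- A proper subset contained in neither part splits into its nonempty traces on s and t, so the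
    -- induction hypothesis applies.
    · intro r hr hr'
      rw [Finset.mem_erase, Finset.mem_powerset] at hr
      rw [Finset.mem_union, Finset.mem_powerset, Finset.mem_powerset, not_or] at hr'
      have hr2 : r = (r ∩ s) ∪ (r ∩ t) := by
        rw [← Finset.inter_union_distrib_left, Finset.inter_eq_left.2 hr.2]
      refine ih r (Finset.ssubset_iff_subset_ne.2 ⟨hr.2, hr.1⟩) (r ∩ s) (r ∩ t) ?_ ?_ ?_ ?_ hr2
      · rw [Finset.nonempty_iff_ne_empty]
        intro h0
        apply hr'.2
        rw [hr2, h0, Finset.empty_union]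
        exact Finset.inter_subset_right
      · rw [Finset.nonempty_iff_ne_empty]
        intro h0
        apply hr'.1
        rw [hr2, h0, Finset.union_empty]
        exact Finset.inter_subset_right
      · exact hd.mono Finset.inter_subset_right Finset.inter_subset_right
      · exact fun x hx y hy => h x (Finset.mem_inter.1 hx).2 y (Finset.mem_inter.1 hy).2

theorem exists_split_of_not_connected (X : ColoredGraph C q V) {u : Finset V} (hu : u.Nonempty)
    (h : ¬ (X.subconf u).IsConnected) :
    ∃ s t : Finset V, s.Nonempty ∧ t.Nonempty ∧ Disjoint s t ∧
      (∀ x ∈ s, ∀ y ∈ t, X.color x y = none) ∧ u = s ∪ t := by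
  rw [isConnected_subconf, SimpleGraph.connected_iff, not_and_or] at h
  obtain ⟨z, hz⟩ := hu
  have hne : Nonempty ((u : Set V) : Type _) := ⟨⟨z, hz⟩⟩
  replace h := h.resolve_right (not_not.2 hne)
  unfold SimpleGraph.Preconnected at h
  push Not at h
  obtain ⟨a, b, hab⟩ := h
  set R := (X.induce (u : Set V)).toSimpleGraph with hR
  -- Split u into the vertices reachable from a inside u and the rest, which contains b.
  refine ⟨u.filter fun x => ∃ hx : x ∈ (u : Set V), R.Reachable a ⟨x, hx⟩,
    u.filter fun x => ¬ ∃ hx : x ∈ (u : Set V), R.Reachable a ⟨x, hx⟩,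
    ⟨a, ?_⟩, ⟨b, ?_⟩, Finset.disjoint_filter_filter_not _ _ _, ?_, ?_⟩
  · rw [Finset.mem_filter]
    exact ⟨a.2, a.2, SimpleGraph.Reachable.refl _⟩
  · rw [Finset.mem_filter]
    exact ⟨b.2, fun ⟨_, h⟩ => hab h⟩
  · intro x hx y hy
    rw [Finset.mem_filter] at hx hy
    by_contra hxy
    obtain ⟨hx1, hx2⟩ := hx.2
    have hadj : R.Adj ⟨x, hx1⟩ ⟨y, hy.1⟩ := hxy
    exact hy.2 ⟨hy.1, hx2.trans hadj.reachable⟩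
  · rw [Finset.filter_union_filter_not_eq]

theorem clusterWeight_of_not_connected (X : ColoredGraph C q V) {u : Finset V} (S : Conf C q)
    (h : ¬ (X.subconf u).IsConnected) : clusterWeight X u S = 0 := by
  rcases u.eq_empty_or_nonempty with rfl | hu
  · exact clusterWeight_empty X S
  · obtain ⟨s, t, h1, h2, h3, h4, h5⟩ := exists_split_of_not_connected X hu h
    exact clusterWeight_union X S u s t h1 h2 h3 h4 h5

/-- The coefficient at `S` of the Lie-like element which belongs to the configuration `U`. -/
def lieCoeff (S U : Conf C q) : ℝ := clusterWeight U.rep Finset.univ S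

theorem clusterWeight_eq (X : ColoredGraph C q V) (u : Finset V) (S : Conf C q) :
    clusterWeight X u S = lieCoeff S (X.subconf u) := by
  obtain ⟨f, hf, hX⟩ := X.exists_embedding u
  rw [lieCoeff, ← hX, clusterWeight_comap, hf]

/-- A sum over subsets of a quantity which depends only on the class of the induced subgraph. -/
theorem sum_subconf_eq (X : ColoredGraph C q V) (w : Finset V) (φ : Conf C q → ℝ)
    (F : Finset (Conf C q)) (hφ : ∀ u ⊆ w, X.subconf u ∉ F → φ (X.subconf u) = 0) :
    ∑ u ∈ w.powerset, φ (X.subconf u) = ∑ U ∈ F, (subCount X w U : ℝ) * φ U := by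
  have h1 : ∑ u ∈ w.powerset, φ (X.subconf u) =
      ∑ u ∈ w.powerset.filter (fun u => X.subconf u ∈ F), φ (X.subconf u) := by
    symm
    apply Finset.sum_subset (Finset.filter_subset _ _)
    intro u hu hu'
    rw [Finset.mem_filter, not_and] at hu'
    exact hφ u (Finset.mem_powerset.1 hu) (hu' hu)
  rw [h1, ← Finset.sum_fiberwise_of_maps_to (g := X.subconf) (t := F)
    (fun u hu => (Finset.mem_filter.1 hu).2)]
  refine Finset.sum_congr rfl fun U hU => ?_
  rw [Finset.sum_congr rfl (g := fun _ => φ U) (fun u hu => by rw [(Finset.mem_filter.1 hu).2]),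
    Finset.sum_const, nsmul_eq_mul]
  congr 2
  unfold subCount
  congr 1
  ext u
  simp only [Finset.mem_filter]
  constructor
  · rintro ⟨⟨h, -⟩, h'⟩
    exact ⟨h, h'⟩
  · rintro ⟨h, rfl⟩
    exact ⟨⟨h, hU⟩, rfl⟩

/-- The connected configurations with at most `n` vertices. -/
def connectedConfs (C : Type u) [InvolutiveInv C] [Finite C] (q n : ℕ) : Finset (Conf C q) :=
  (finite_size_le n).toFinset.filter IsConnected

theorem mem_connectedConfs [Finite C] {n : ℕ} {S : Conf C q} :
    S ∈ connectedConfs C q n ↔ S.size ≤ n ∧ S.IsConnected := by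
  simp [connectedConfs]

/-- The cluster expansion sorted by classes: weights vanish on subsets larger than S and on
disconnected ones, so the index set is finite and independent of X and w. -/
theorem logGrowth_eq_sum [Finite C] (X : ColoredGraph C q V) (w : Finset V) (S : Conf C q) :
    logGrowth X w S =
      ∑ U ∈ connectedConfs C q S.size, (subCount X w U : ℝ) * lieCoeff S U := by
  rw [logGrowth_eq_sum_clusterWeight]
  simp only [clusterWeight_eq]
  refine sum_subconf_eq X w _ _ fun u _ hu => ?_
  rw [← clusterWeight_eq]
  rw [mem_connectedConfs, not_and_or, size_subconf, not_le] at hu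
  rcases hu with hu | hu
  · exact clusterWeight_of_size_lt X hu
  · exact clusterWeight_of_not_connected X S hu

theorem not_isConnected_mul {S T : Conf C q} (hS : S ≠ 1) (hT : T ≠ 1) :
    ¬ (S * T).IsConnected := by
  rw [← conf_rep S, ← conf_rep T, conf_mul_conf, isConnected_conf]
  intro h
  have hS' : 0 < S.size := Nat.pos_of_ne_zero fun h => hS (size_eq_zero_iff.1 h)
  have hT' : 0 < T.size := Nat.pos_of_ne_zero fun h => hT (size_eq_zero_iff.1 h)
  have key : ∀ a b, (S.rep.sum T.rep).toSimpleGraph.Walk a b → a.isLeft = b.isLeft := by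
    intro a b p
    induction p with
    | nil => rfl
    | @cons x y z hxy _ ih =>
      rw [← ih]
      rcases x with x | x <;> rcases y with y | y
      · rfl
      · exact absurd rfl hxy
      · exact absurd rfl hxy
      · rfl
  obtain ⟨p⟩ := h.preconnected (Sum.inl ⟨0, hS'⟩) (Sum.inr ⟨0, hT'⟩)
  exact Bool.noConfusion (key _ _ p)

/-- At a connected configuration the logarithmic growth function counts subgraphs. -/
theorem logGrowth_of_isConnected (X : ColoredGraph C q V) (w : Finset V) {S : Conf C q}
    (hS : S.IsConnected) : logGrowth X w S = subCount X w S := by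
  have hpos := hS.size_pos
  unfold logGrowth logCoeff
  -- The n-th power involves products of n nontrivial configurations; for n ≥ 2 these are
  -- disconnected, so only the linear term reaches a connected S.
  rw [Finset.sum_eq_single_of_mem 1]
  · rw [pow_one, MonoidAlgebra.coeff_sub, Finsupp.sub_apply, coeff_growthElement,
      MonoidAlgebra.one_def, MonoidAlgebra.coeff_single, Finsupp.single_apply, if_neg]
    · simp
    · rintro rfl
      rw [size_one] at hpos
      omega
  · exact Finset.mem_Icc.2 ⟨le_rfl, hpos⟩
  · intro n hn hn1
    rw [coeff_growthElement_pow, Finset.sum_eq_zero, mul_zero]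
    intro u _
    rw [Nat.cast_eq_zero, Finset.card_eq_zero, Finset.eq_empty_iff_forall_notMem]
    intro s hs
    simp only [coveringTuples, Finset.mem_filter, Fintype.mem_piFinset] at hs
    obtain ⟨k, rfl⟩ : ∃ k, n = k + 2 := ⟨n - 2, by have := (Finset.mem_Icc.1 hn).1; omega⟩
    have h1 : ∀ i, X.subconf (s i) ≠ 1 := fun i h =>
      (hs.1 i).2.ne_empty (subconf_eq_one_iff.1 h)
    rw [← hs.2.1, Fin.prod_univ_succ] at hS
    refine not_isConnected_mul (h1 0) ?_ hS
    intro h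
    have h2 := congrArg sizeHom h
    rw [Fin.prod_univ_succ, map_mul, map_one] at h2
    have h3 := congrArg Multiplicative.toAdd h2
    rw [toAdd_mul, toAdd_one] at h3
    have h4 : (X.subconf (s (Fin.succ 0))).size = 0 := (Nat.add_eq_zero_iff.1 h3).1
    exact h1 _ (size_eq_zero_iff.1 h4)

end GrowthElement

/-! ### Logarithms in tensor powers of a monoid algebra -/

section LogarithmOfProducts

variable {P : Type u} [CommMonoid P] {wt : P →* Multiplicative ℕ}

theorem unipotent_prod {ι : Type*} {a : ι → MonoidAlgebra ℝ P}
    (ha : ∀ i p, (wt p).toAdd = 0 → (a i - 1).coeff p = 0) (s : Finset ι) (p : P)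
    (hp : (wt p).toAdd = 0) : (∏ i ∈ s, a i - 1).coeff p = 0 := by
  induction s using Finset.induction_on generalizing p with
  | empty => simp
  | insert i s hi ih =>
    rw [Finset.prod_insert hi]
    exact unipotent_mul (ha i) ih p hp

theorem logCoeff_prod {ι : Type*} {a : ι → MonoidAlgebra ℝ P}
    (ha : ∀ i p, (wt p).toAdd = 0 → (a i - 1).coeff p = 0) (s : Finset ι) (p : P) :
    logCoeff wt (∏ i ∈ s, a i) p = ∑ i ∈ s, logCoeff wt (a i) p := by
  induction s using Finset.induction_on with
  | empty =>
    rw [Finset.prod_empty, Finset.sum_empty, logCoeff]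
    refine Finset.sum_eq_zero fun n hn => ?_
    rw [sub_self, zero_pow (by have := (Finset.mem_Icc.1 hn).1; omega)]
    simp
  | insert i s hi ih =>
    rw [Finset.prod_insert hi, Finset.sum_insert hi, logCoeff_mul (ha i) (unipotent_prod ha s), ih]

/-- The embedding of a monoid algebra as the `i`-th factor of a tensor power. -/
def factorHom (P : Type u) [CommMonoid P] {m : ℕ} (i : Fin m) :
    MonoidAlgebra ℝ P →+* MonoidAlgebra ℝ (Fin m → P) :=
  MonoidAlgebra.mapDomainRingHom ℝ (MonoidHom.mulSingle (fun _ => P) i)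

theorem factorHom_single {m : ℕ} (i : Fin m) (p : P) (b : ℝ) :
    factorHom P i (MonoidAlgebra.single p b) = MonoidAlgebra.single (Pi.mulSingle i p) b := by
  simp [factorHom]

theorem coeff_factorHom {m : ℕ} (i : Fin m) (x : MonoidAlgebra ℝ P) (p : Fin m → P) :
    (factorHom P i x).coeff p = if p = Pi.mulSingle i (p i) then x.coeff (p i) else 0 := by
  induction x using MonoidAlgebra.induction_linear with
  | zero => simp
  | add x y hx hy =>
    rw [map_add, MonoidAlgebra.coeff_add, Finsupp.add_apply, hx, hy, MonoidAlgebra.coeff_add,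
      Finsupp.add_apply]
    split_ifs <;> simp
  | single r b =>
    rw [factorHom_single, MonoidAlgebra.coeff_single, MonoidAlgebra.coeff_single,
      Finsupp.single_apply, Finsupp.single_apply]
    by_cases h : Pi.mulSingle i r = p
    · subst h
      simp
    · rw [if_neg h]
      split_ifs with h1 h2
      · exact absurd (by rw [h2, ← h1]) h
      · rfl
      · rfl

/-- The total weight of a tuple. -/
def tupleWeight (wt : P →* Multiplicative ℕ) (m : ℕ) : (Fin m → P) →* Multiplicative ℕ :=
  ∏ i, wt.comp (Pi.evalMonoidHom (fun _ => P) i)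

theorem toAdd_tupleWeight (m : ℕ) (p : Fin m → P) :
    (tupleWeight wt m p).toAdd = ∑ i, (wt (p i)).toAdd := by
  rw [tupleWeight, MonoidHom.finsetProd_apply, toAdd_prod]
  rfl

theorem factorHom_unipotent {a : MonoidAlgebra ℝ P}
    (ha : ∀ p, (wt p).toAdd = 0 → (a - 1).coeff p = 0) {m : ℕ} (i : Fin m) (p : Fin m → P)
    (hp : (tupleWeight wt m p).toAdd = 0) : (factorHom P i a - 1).coeff p = 0 := by
  rw [← map_one (factorHom P i), ← map_sub, coeff_factorHom]
  split_ifs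
  · rw [toAdd_tupleWeight, Finset.sum_eq_zero_iff] at hp
    exact ha _ (hp i (Finset.mem_univ i))
  · rfl

/-- Powers commute with the ring homomorphism, and the truncations match because a tuple supported
at i has total weight equal to the weight of its i-th entry. -/
theorem logCoeff_factorHom {m : ℕ} (i : Fin m) (a : MonoidAlgebra ℝ P) (p : Fin m → P) :
    logCoeff (tupleWeight wt m) (factorHom P i a) p =
      if p = Pi.mulSingle i (p i) then logCoeff wt a (p i) else 0 := by
  unfold logCoeff
  have h : ∀ n, (factorHom P i a - 1) ^ n = factorHom P i ((a - 1) ^ n) := by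
    intro n
    rw [map_pow, map_sub, map_one]
  simp only [h, coeff_factorHom]
  split_ifs with hp
  · have hw : (tupleWeight wt m p).toAdd = (wt (p i)).toAdd := by
      rw [toAdd_tupleWeight]
      apply Finset.sum_eq_single_of_mem i (Finset.mem_univ i)
      intro j _ hj
      rw [hp, Pi.mulSingle_eq_of_ne hj, map_one, toAdd_one]
    rw [hw]
  · simp

end LogarithmOfProducts

/-! ### Coproducts and Lie-like elements -/

section LieLike

variable {C : Type u} [InvolutiveInv C] {q : ℕ} {V : Type v} {W : Type w}

/-- The sum over all coverings of `w` by `m` subsets of the tuples of induced subgraphs. -/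
def coverElement (X : ColoredGraph C q V) (m : ℕ) (w : Finset V) :
    MonoidAlgebra ℝ (Fin m → Conf C q) :=
  ∑ s ∈ (Fintype.piFinset fun _ : Fin m => w.powerset).filter fun s => ∀ x ∈ w, ∃ i, x ∈ s i,
    MonoidAlgebra.single (fun i => X.subconf (s i)) 1

theorem coverElement_comap (X : ColoredGraph C q V) (f : W ↪ V) (m : ℕ) (w : Finset W) :
    coverElement (X.comap f) m w = coverElement X m (w.map f) := by
  refine Finset.sum_nbij (fun s i => (s i).map f) ?_ ?_ ?_ ?_
  · intro s hs
    simp only [Finset.mem_filter, Fintype.mem_piFinset, Finset.mem_powerset,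
      Finset.map_subset_map, Finset.mem_map] at hs ⊢
    refine ⟨hs.1, ?_⟩
    rintro _ ⟨x, hx, rfl⟩
    obtain ⟨i, hi⟩ := hs.2 x hx
    exact ⟨i, x, hi, rfl⟩
  · intro s _ t _ hst
    funext i
    exact Finset.map_injective f (congrFun hst i)
  · intro s hs
    simp only [Finset.coe_filter, Set.mem_ofPred_eq, Fintype.mem_piFinset,
      Finset.mem_powerset] at hs
    have h : ∀ i, ∃ u ⊆ w, s i = u.map f := fun i => Finset.subset_map_iff.1 (hs.1 i)
    choose t ht hst using h
    refine ⟨t, ?_, funext fun i => (hst i).symm⟩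
    simp only [Finset.coe_filter, Set.mem_ofPred_eq, Fintype.mem_piFinset, Finset.mem_powerset]
    refine ⟨ht, fun x hx => ?_⟩
    obtain ⟨i, hi⟩ := hs.2 (f x) (Finset.mem_map_of_mem f hx)
    exact ⟨i, (Finset.mem_map' f).1 (hst i ▸ hi)⟩
  · intro s _
    simp only [subconf_comap]

theorem coverElement_empty (X : ColoredGraph C q V) (m : ℕ) : coverElement X m ∅ = 1 := by
  unfold coverElement
  rw [Finset.sum_eq_single_of_mem (fun _ => ∅)]
  · rw [MonoidAlgebra.one_def]
    congr 1
    funext i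
    exact subconf_eq_one_iff.2 rfl
  · simp
  · intro s hs hs'
    simp only [Finset.mem_filter, Fintype.mem_piFinset, Finset.mem_powerset,
      Finset.subset_empty] at hs
    exact absurd (funext hs.1) hs'

/-- Coverings of s ∪ t are pairs of coverings of the two parts. This multiplicativity makes the
coproduct an algebra homomorphism. -/
theorem coverElement_union [DecidableEq V] (X : ColoredGraph C q V) (m : ℕ) {s t : Finset V}
    (hd : Disjoint s t)
    (h : ∀ x ∈ s, ∀ y ∈ t, X.color x y = none) :
    coverElement X m (s ∪ t) = coverElement X m s * coverElement X m t := by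
  unfold coverElement
  rw [Finset.sum_mul_sum, ← Finset.sum_product']
  symm
  refine Finset.sum_nbij' (fun p i => p.1 i ∪ p.2 i)
    (fun u => (fun i => u i ∩ s, fun i => u i ∩ t)) ?_ ?_ ?_ ?_ ?_
  · intro p hp
    simp only [Finset.mem_product, Finset.mem_filter, Fintype.mem_piFinset,
      Finset.mem_powerset] at hp ⊢
    refine ⟨fun i => Finset.union_subset_union (hp.1.1 i) (hp.2.1 i), fun x hx => ?_⟩
    rcases Finset.mem_union.1 hx with hx | hx
    · obtain ⟨i, hi⟩ := hp.1.2 x hx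
      exact ⟨i, Finset.mem_union_left _ hi⟩
    · obtain ⟨i, hi⟩ := hp.2.2 x hx
      exact ⟨i, Finset.mem_union_right _ hi⟩
  · intro u hu
    simp only [Finset.mem_product, Finset.mem_filter, Fintype.mem_piFinset,
      Finset.mem_powerset] at hu ⊢
    refine ⟨⟨fun _ => Finset.inter_subset_right, fun x hx => ?_⟩,
      fun _ => Finset.inter_subset_right, fun x hx => ?_⟩
    · obtain ⟨i, hi⟩ := hu.2 x (Finset.mem_union_left _ hx)
      exact ⟨i, Finset.mem_inter.2 ⟨hi, hx⟩⟩
    · obtain ⟨i, hi⟩ := hu.2 x (Finset.mem_union_right _ hx)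
      exact ⟨i, Finset.mem_inter.2 ⟨hi, hx⟩⟩
  · rintro ⟨a, b⟩ hp
    simp only [Finset.mem_product, Finset.mem_filter, Fintype.mem_piFinset,
      Finset.mem_powerset] at hp
    have h1 : ∀ i, b i ∩ s = ∅ := fun i =>
      Finset.disjoint_iff_inter_eq_empty.1 (hd.symm.mono_left (hp.2.1 i))
    have h2 : ∀ i, a i ∩ t = ∅ := fun i =>
      Finset.disjoint_iff_inter_eq_empty.1 (hd.mono_left (hp.1.1 i))
    simp only [Finset.union_inter_distrib_right, h1, h2,
      Finset.inter_eq_left.2 (hp.1.1 _), Finset.inter_eq_left.2 (hp.2.1 _), Finset.union_empty,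
      Finset.empty_union]
  · intro u hu
    simp only [Finset.mem_filter, Fintype.mem_piFinset, Finset.mem_powerset] at hu
    funext i
    simp only
    rw [← Finset.inter_union_distrib_left, Finset.inter_eq_left.2 (hu.1 i)]
  · rintro ⟨a, b⟩ hp
    simp only [Finset.mem_product, Finset.mem_filter, Fintype.mem_piFinset,
      Finset.mem_powerset] at hp
    simp only
    rw [MonoidAlgebra.single_mul_single, mul_one]
    congr 1
    funext i
    exact (X.subconf_disjUnion (hd.mono (hp.1.1 i) (hp.2.1 i))
      fun x hx y hy => h x (hp.1.1 i hx) y (hp.2.1 i hy)).symm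

theorem coverElement_eq (X : ColoredGraph C q V) (m : ℕ) (w : Finset V) :
    coverElement X m w = coverElement (X.subconf w).rep m Finset.univ := by
  obtain ⟨f, hf, hX⟩ := X.exists_embedding w
  rw [← hX, coverElement_comap, hf]

theorem coverElement_conf [Fintype V] (X : ColoredGraph C q V) (m : ℕ) :
    coverElement X m Finset.univ = coverElement X.conf.rep m Finset.univ := by
  rw [coverElement_eq, subconf_univ]

/-- The coproduct of a configuration. -/
def coverHom (C : Type u) [InvolutiveInv C] (q m : ℕ) :
    Conf C q →* MonoidAlgebra ℝ (Fin m → Conf C q) where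
  toFun U := coverElement U.rep m Finset.univ
  map_one' := by
    have : IsEmpty (Fin (1 : Conf C q).size) := by rw [size_one]; infer_instance
    rw [Finset.univ_eq_empty, coverElement_empty]
  map_mul' S T := by
    have h1 : S * T = (S.rep.sum T.rep).conf := by rw [← conf_mul_conf, conf_rep, conf_rep]
    rw [h1, ← coverElement_conf]
    have h2 : (Finset.univ : Finset (Fin S.size ⊕ Fin T.size)) =
        Finset.univ.map Function.Embedding.inl ∪ Finset.univ.map Function.Embedding.inr := by
      ext (x | x) <;> simp
    rw [h2, coverElement_union, ← coverElement_comap, ← coverElement_comap]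
    · rfl
    · rw [Finset.disjoint_left]
      simp
    · intro x hx y hy
      obtain ⟨a, -, rfl⟩ := Finset.mem_map.1 hx
      obtain ⟨b, -, rfl⟩ := Finset.mem_map.1 hy
      rfl

theorem coeff_coverHom (m : ℕ) (U : Conf C q) (S : Fin m → Conf C q) :
    (coverHom C q m U).coeff S = coveringCoeff U S := by
  change (coverElement U.rep m Finset.univ).coeff S = _
  rw [coverElement, MonoidAlgebra.coeff_sum, Finsupp.finsetSum_apply]
  simp only [MonoidAlgebra.coeff_single, Finsupp.single_apply]
  rw [← Finset.sum_filter, Finset.sum_const, nsmul_eq_mul, mul_one]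
  congr 1
  symm
  apply Nat.subtype_card
  intro s
  simp only [Finset.mem_filter, Fintype.mem_piFinset, Finset.mem_powerset, Finset.subset_univ,
    Finset.mem_univ, forall_true_left, implies_true, true_and, funext_iff]
  exact and_comm

/-- Makes each coefficient of the coproduct a finite sum, hence continuous in the series. -/
theorem coveringCoeff_eq_zero {m : ℕ} {U : Conf C q} {S : Fin m → Conf C q}
    (h : ∑ i, (S i).size < U.size) : coveringCoeff U S = 0 := by
  unfold coveringCoeff
  rw [Nat.card_eq_zero]
  left
  refine ⟨?_⟩
  rintro ⟨s, hs, hc⟩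
  have h1 : Finset.univ ⊆ Finset.univ.biUnion s := by
    intro x _
    obtain ⟨i, hi⟩ := hc x
    exact Finset.mem_biUnion.2 ⟨i, Finset.mem_univ i, hi⟩
  have h2 : ∀ i, (S i).size = (s i).card := fun i => by
    rw [← hs i]
    exact size_subconf _ _
  simp only [h2] at h
  have h3 := (Finset.card_le_card h1).trans Finset.card_biUnion_le
  rw [Finset.card_univ, Fintype.card_fin] at h3
  omega

theorem coprod_eq_sum [Finite C] {m : ℕ} (f : ConfSeries C q) (S : Fin m → Conf C q) :
    ConfSeries.coprod m f S =
      ∑ U ∈ (finite_size_le (∑ i, (S i).size)).toFinset, (coveringCoeff U S : ℝ) * f U := by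
  unfold ConfSeries.coprod
  apply finsum_eq_sum_of_support_subset
  intro U hU
  rw [Set.Finite.coe_toFinset, Set.mem_ofPred_eq]
  by_contra! h
  exact hU (by simp [coveringCoeff_eq_zero h])

/-- The coproduct on the monoid algebra. -/
def coprodHom (C : Type u) [InvolutiveInv C] (q m : ℕ) :
    MonoidAlgebra ℝ (Conf C q) →ₐ[ℝ] MonoidAlgebra ℝ (Fin m → Conf C q) :=
  MonoidAlgebra.lift ℝ _ _ (coverHom C q m)

theorem coeff_coprodHom [Finite C] {m : ℕ} (x : MonoidAlgebra ℝ (Conf C q))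
    (S : Fin m → Conf C q) :
    (coprodHom C q m x).coeff S =
      ∑ U ∈ (finite_size_le (∑ i, (S i).size)).toFinset, (coveringCoeff U S : ℝ) * x.coeff U := by
  induction x using MonoidAlgebra.induction_linear with
  | zero => simp
  | add x y hx hy =>
    rw [map_add, MonoidAlgebra.coeff_add, Finsupp.add_apply, hx, hy, ← Finset.sum_add_distrib]
    simp [mul_add]
  | single r b =>
    rw [coprodHom, MonoidAlgebra.lift_single, MonoidAlgebra.coeff_smul_apply, coeff_coverHom,
      MonoidAlgebra.coeff_single]
    simp only [Finsupp.single_apply, mul_ite, mul_zero]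
    rw [Finset.sum_ite_eq]
    split_ifs with h
    · rw [smul_eq_mul, mul_comm]
    · rw [Set.Finite.mem_toFinset, Set.mem_ofPred_eq, not_le] at h
      simp [coveringCoeff_eq_zero h]

/-- The growth function is group-like: an arbitrary m-tuple of subsets of w is the same as a subset
u, its union, together with a covering of u by m subsets. -/
theorem coprodHom_growthElement (X : ColoredGraph C q V) (m : ℕ) (w : Finset V) :
    coprodHom C q m (growthElement X w) = ∏ i : Fin m, factorHom _ i (growthElement X w) := by
  have h1 : ∏ i : Fin m, factorHom _ i (growthElement X w) =
      ∑ s ∈ Fintype.piFinset fun _ : Fin m => w.powerset,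
        MonoidAlgebra.single (fun i => X.subconf (s i)) 1 := by
    simp only [growthElement, map_sum, factorHom_single]
    rw [Finset.prod_univ_sum]
    refine Finset.sum_congr rfl fun s _ => ?_
    have h2 : ∏ i, MonoidAlgebra.single (Pi.mulSingle i (X.subconf (s i))) (1 : ℝ) =
        MonoidAlgebra.single (∏ i, Pi.mulSingle i (X.subconf (s i))) 1 :=
      (map_prod (MonoidAlgebra.of ℝ (Fin m → Conf C q)) _ _).symm
    rw [h2, Finset.univ_prod_mulSingle (fun i => X.subconf (s i))]
  rw [h1, growthElement, map_sum, ← Finset.sum_fiberwise_of_maps_to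
    (g := fun s => Finset.univ.biUnion s) (t := w.powerset)]
  · refine Finset.sum_congr rfl fun u hu => ?_
    rw [coprodHom, MonoidAlgebra.lift_single, one_smul]
    change coverElement (X.subconf u).rep m Finset.univ = _
    rw [← coverElement_eq, coverElement]
    refine Finset.sum_congr ?_ fun _ _ => rfl
    ext s
    simp only [Finset.mem_filter, Fintype.mem_piFinset, Finset.mem_powerset] at hu ⊢
    constructor
    · rintro ⟨hs, hc⟩
      refine ⟨fun i => (hs i).trans hu, ?_⟩
      apply Finset.Subset.antisymm
      · exact Finset.biUnion_subset.2 fun i _ => hs i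
      · intro x hx
        simpa using hc x hx
    · rintro ⟨-, rfl⟩
      exact ⟨fun i => Finset.subset_biUnion_of_mem s (Finset.mem_univ i),
        fun x hx => by simpa using hx⟩
  · intro s hs
    simp only [Fintype.mem_piFinset, Finset.mem_powerset] at hs ⊢
    exact Finset.biUnion_subset.2 fun i _ => hs i

/-- The logarithm turns the product in `coprodHom_growthElement` into a sum over the m factors. The
scalar c accommodates the normalization by #Γ_n. -/
theorem isLieLike_logGrowth [Finite C] (X : ColoredGraph C q V) (w : Finset V) (c : ℝ) :
    ConfSeries.IsLieLike (fun S => c * logGrowth X w S) := by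
  intro m S
  have h1 : ∑ U ∈ (finite_size_le (C := C) (q := q) (∑ i, (S i).size)).toFinset,
      (coveringCoeff U S : ℝ) * logGrowth X w U =
      logCoeff (tupleWeight sizeHom m) (∏ i : Fin m, factorHom _ i (growthElement X w)) S := by
    rw [← coprodHom_growthElement, logCoeff, toAdd_tupleWeight]
    have h2 : ∀ n, (coprodHom C q m (growthElement X w) - 1) ^ n =
        coprodHom C q m ((growthElement X w - 1) ^ n) := fun n => by
      rw [map_pow, map_sub, map_one]
    simp only [h2, coeff_coprodHom, Finset.mul_sum]
    rw [Finset.sum_comm]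
    refine Finset.sum_congr rfl fun U hU => ?_
    rw [Set.Finite.mem_toFinset] at hU
    rw [logGrowth, logCoeff_eq_sum (growthElement_unipotent X w) hU, Finset.mul_sum]
    refine Finset.sum_congr rfl fun n _ => ?_
    ring
  have h3 : ConfSeries.coprod m (fun S => c * logGrowth X w S) S =
      c * ∑ U ∈ (finite_size_le (C := C) (q := q) (∑ i, (S i).size)).toFinset,
        (coveringCoeff U S : ℝ) * logGrowth X w U := by
    rw [coprod_eq_sum, Finset.mul_sum]
    refine Finset.sum_congr rfl fun U _ => ?_
    ring
  rw [h3, h1, logCoeff_prod (fun i => factorHom_unipotent (growthElement_unipotent X w) i),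
    Finset.mul_sum]
  refine Finset.sum_congr rfl fun i _ => ?_
  rw [logCoeff_factorHom, mul_ite, mul_zero]
  refine if_congr ?_ rfl rfl
  constructor
  · intro h j hj
    rw [h, Pi.mulSingle_eq_of_ne hj]
    rfl
  · intro h
    funext j
    by_cases hj : j = i
    · subst hj
      simp
    · rw [Pi.mulSingle_eq_of_ne hj]
      exact h j hj

theorem isClosed_isLieLike [Finite C] : IsClosed {f : ConfSeries C q | f.IsLieLike} := by
  simp only [ConfSeries.IsLieLike, Set.ofPred_forall, coprod_eq_sum]
  refine isClosed_iInter fun m => isClosed_iInter fun S => isClosed_eq ?_ ?_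
  · fun_prop
  · refine continuous_finsetSum _ fun i _ => ?_
    split_ifs <;> fun_prop

end LieLike

/-! ### Local counting: bounded valency, hulls and the kabi map -/

section Hull

variable {C : Type u} [InvolutiveInv C] {q : ℕ} {V : Type v} {W : Type w}

namespace ColoredGraph

theorem finite_neighbors (X : ColoredGraph C q V) (x : V) : {y | X.color x y ≠ none}.Finite :=
  Set.finite_of_encard_le_coe (X.valency x)

/-- The neighbors of a vertex. -/
def neighbors (X : ColoredGraph C q V) (x : V) : Finset V := (X.finite_neighbors x).toFinset

theorem mem_neighbors {X : ColoredGraph C q V} {x y : V} :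
    y ∈ X.neighbors x ↔ X.color x y ≠ none := by
  simp [neighbors]

theorem card_neighbors_le (X : ColoredGraph C q V) (x : V) : (X.neighbors x).card ≤ q := by
  have h := X.valency x
  rw [(X.finite_neighbors x).encard_eq_coe_toFinset_card] at h
  exact_mod_cast h

theorem color_ne_none_comm (X : ColoredGraph C q V) {x y : V} :
    X.color x y ≠ none ↔ X.color y x ≠ none := by
  rw [X.color_swap x y]
  simp

/-- The vertices which are reached from `x` by walks of length at most `k`. -/
def reach (X : ColoredGraph C q V) (x : V) : ℕ → Finset V
  | 0 => {x}
  | k + 1 => (reach X x k).biUnion fun y => insert y (X.neighbors y)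

theorem card_reach_le (X : ColoredGraph C q V) (x : V) (k : ℕ) :
    (X.reach x k).card ≤ (q + 1) ^ k := by
  induction k with
  | zero => simp [reach]
  | succ k ih =>
    rw [reach, pow_succ]
    refine (Finset.card_biUnion_le_card_mul _ _ (q + 1) fun y _ => ?_).trans
      (Nat.mul_le_mul_right _ ih)
    exact (Finset.card_insert_le _ _).trans (Nat.succ_le_succ (X.card_neighbors_le y))

theorem reach_subset_reach (X : ColoredGraph C q V) (x : V) {k l : ℕ} (h : k ≤ l) :
    X.reach x k ⊆ X.reach x l := by
  induction h with
  | refl => exact Finset.Subset.refl _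
  | @step l _ ih =>
    refine ih.trans fun y hy => ?_
    exact Finset.mem_biUnion.2 ⟨y, hy, Finset.mem_insert_self _ _⟩

/-- Two vertices of a connected subgraph are joined by a path inside it, which has fewer edges than
the subgraph has vertices. -/
theorem subset_reach (X : ColoredGraph C q V) {s : Finset V} (hs : (X.subconf s).IsConnected)
    {x : V} (hx : x ∈ s) : s ⊆ X.reach x s.card := by
  rw [isConnected_subconf] at hs
  have key : ∀ (a b : (s : Set V)) (p : (X.induce (s : Set V)).toSimpleGraph.Walk a b),
      (b : V) ∈ X.reach a p.length := by
    intro a b p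
    induction p using SimpleGraph.Walk.concatRec with
    | Hnil => simp [reach]
    | Hconcat p h ih =>
      rw [SimpleGraph.Walk.length_concat, reach]
      exact Finset.mem_biUnion.2 ⟨_, ih, Finset.mem_insert_of_mem (mem_neighbors.2 h)⟩
  intro y hy
  obtain ⟨p⟩ := hs.preconnected ⟨x, hx⟩ ⟨y, hy⟩
  have h1 := key _ _ p.toPath.1
  have h2 : (p.toPath.1).length < s.card := by simpa using p.toPath.2.length_lt
  exact X.reach_subset_reach x h2.le h1

theorem connected_of_adjacent (X : ColoredGraph C q V) {s u : Finset V}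
    (hs : (X.subconf s).IsConnected) (hsu : s ⊆ u)
    (h : ∀ y ∈ u, y ∉ s → ∃ x ∈ s, X.color x y ≠ none) : (X.subconf u).IsConnected := by
  rw [isConnected_subconf] at hs ⊢
  obtain ⟨z⟩ := hs.nonempty
  let f : (X.induce (s : Set V)).toSimpleGraph →g (X.induce (u : Set V)).toSimpleGraph :=
    ⟨fun x => ⟨x, hsu x.2⟩, fun h => h⟩
  rw [SimpleGraph.connected_iff_exists_forall_reachable]
  refine ⟨f z, ?_⟩
  have key : ∀ y (hy : y ∈ s), (X.induce (u : Set V)).toSimpleGraph.Reachable (f z)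
      ⟨y, hsu hy⟩ := fun y hy => (hs.preconnected z ⟨y, hy⟩).map f
  rintro ⟨y, hy⟩
  by_cases hys : y ∈ s
  · exact key y hys
  · obtain ⟨x, hx, hxy⟩ := h y hy hys
    have hadj : (X.induce (u : Set V)).toSimpleGraph.Adj ⟨x, hsu hx⟩ ⟨y, hy⟩ := hxy
    exact (key x hx).trans hadj.reachable

theorem exists_adjacent_of_connected (X : ColoredGraph C q V) {s u : Finset V}
    (hu : (X.subconf u).IsConnected) (hsu : s ⊆ u) (hs : s.Nonempty) (hne : s ≠ u) :
    ∃ x ∈ s, ∃ y ∈ u, y ∉ s ∧ X.color x y ≠ none := by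
  rw [isConnected_subconf] at hu
  by_contra! h
  obtain ⟨x, hx⟩ := hs
  apply hne
  refine Finset.Subset.antisymm hsu fun y hy => ?_
  have key : ∀ (a b : (u : Set V)), (X.induce (u : Set V)).toSimpleGraph.Walk a b →
      (a : V) ∈ s → (b : V) ∈ s := by
    intro a b p
    induction p with
    | nil => exact id
    | @cons a b c hab p ih =>
      intro ha
      apply ih
      by_contra hb
      exact hab (h a ha b b.2 hb)
  obtain ⟨p⟩ := hu.preconnected ⟨x, hsu hx⟩ ⟨y, hy⟩
  exact key _ _ p hx

end ColoredGraph

/-- The number of connected full subgraphs in a given class which meet a given set is at most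
proportional to the number of elements of this set. -/
theorem card_filter_meet_le (X : ColoredGraph C q V) (w d : Finset V) {S : Conf C q}
    (hS : S.IsConnected) :
    (w.powerset.filter fun s => X.subconf s = S ∧ ∃ x ∈ s, x ∈ d).card ≤
      d.card * 2 ^ (q + 1) ^ S.size := by
  -- A connected copy through x lies in the reach of x, which has at most (q+1)^#S vertices; this is
  -- the source of the constant.
  have h : (w.powerset.filter fun s => X.subconf s = S ∧ ∃ x ∈ s, x ∈ d) ⊆
      d.biUnion fun x => (X.reach x S.size).powerset := by
    intro s hs
    obtain ⟨-, rfl, x, hx, hd⟩ := Finset.mem_filter.1 hs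
    rw [size_subconf]
    exact Finset.mem_biUnion.2 ⟨x, hd, Finset.mem_powerset.2 (X.subset_reach hS hx)⟩
  refine (Finset.card_le_card h).trans (Finset.card_biUnion_le_card_mul _ _ _ fun x _ => ?_)
  rw [Finset.card_powerset]
  exact Nat.pow_le_pow_right two_pos (X.card_reach_le x _)

theorem subCount_le (X : ColoredGraph C q V) (w : Finset V) {S : Conf C q}
    (hS : S.IsConnected) : subCount X w S ≤ w.card * 2 ^ (q + 1) ^ S.size := by
  refine (Finset.card_le_card ?_).trans (card_filter_meet_le X w w hS)
  intro s hs
  obtain ⟨hsw, rfl⟩ := Finset.mem_filter.1 hs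
  have h := hS.size_pos
  rw [size_subconf, Finset.card_pos] at h
  obtain ⟨x, hx⟩ := h
  exact Finset.mem_filter.2 ⟨hsw, rfl, x, hx, Finset.mem_powerset.1 hsw hx⟩

/-- The subsets `s` of `u` in the class `S` such that all vertices of `s` have neighbors in `u` for
all colors in `D`, and all vertices of `u` outside of `s` are joined to `s` by a color in `R`. -/
def hullSubsets (X : ColoredGraph C q V) (D R : Set C) (S : Conf C q) (u : Finset V) :
    Finset (Finset V) :=
  u.powerset.filter fun s => X.subconf s = S ∧ (∀ x ∈ s, ∀ c ∈ D, ∃ y ∈ u, X.color x y = some c) ∧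
    ∀ y ∈ u, y ∉ s → ∃ x ∈ s, ∃ c ∈ R, X.color x y = some c

theorem card_hullSubsets_comap (X : ColoredGraph C q V) (f : W ↪ V) (D R : Set C) (S : Conf C q)
    (w : Finset W) :
    (hullSubsets (X.comap f) D R S w).card = (hullSubsets X D R S (w.map f)).card := by
  unfold hullSubsets
  rw [powerset_map, Finset.filter_map, Finset.card_map]
  congr 1
  have hex : ∀ (t : Finset W) (p : V → Prop), (∃ y ∈ t.map f, p y) ↔ ∃ y ∈ t, p (f y) := by
    simp
  refine Finset.filter_congr fun s _ => ?_
  simp only [Function.comp_apply, RelEmbedding.coe_toEmbedding, Finset.mapEmbedding_apply,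
    subconf_comap, Finset.forall_mem_map, hex, Finset.mem_map']
  rfl

/-- The number of subsets of a representative of `U` with hull `U`. -/
def hullCoeff (D R : Set C) (S U : Conf C q) : ℕ := (hullSubsets U.rep D R S Finset.univ).card

theorem card_hullSubsets (X : ColoredGraph C q V) (D R : Set C) (S : Conf C q) (u : Finset V) :
    (hullSubsets X D R S u).card = hullCoeff D R S (X.subconf u) := by
  obtain ⟨f, hf, hX⟩ := X.exists_embedding u
  rw [hullCoeff, ← hX, card_hullSubsets_comap, hf]

/-- The kabi coefficient imposes no saturation (`D` empty) and allows every color on the joining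
edges (`R` everything), so one counting lemma serves both the kabi map and the shift. -/
theorem kabiCoeff_eq_hullCoeff (S U : Conf C q) : kabiCoeff S U = hullCoeff ∅ Set.univ S U := by
  unfold kabiCoeff hullCoeff
  apply Nat.subtype_card
  intro s
  simp only [hullSubsets, Finset.mem_filter, Finset.mem_powerset, Finset.subset_univ, true_and,
    Set.mem_empty_iff_false, Set.mem_univ, Finset.mem_univ, forall_true_left, IsEmpty.forall_iff,
    implies_true]
  refine and_congr Iff.rfl (forall_congr' fun y => forall_congr' fun _ => exists_congr fun x =>
    and_congr Iff.rfl ?_)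
  rw [color_ne_none_comm, Option.ne_none_iff_exists']

/-- Each vertex of u is in s or adjacent to s. Hence u is connected along with s, and has at most q
+ 1 vertices per vertex of s. -/
theorem hullSubsets_nonempty (X : ColoredGraph C q V) {D R : Set C} {S : Conf C q}
    (hS : S.IsConnected) {u : Finset V} (h : (hullSubsets X D R S u).Nonempty) :
    (X.subconf u).size ≤ S.size * (q + 1) ∧ (X.subconf u).IsConnected := by
  obtain ⟨s, hs⟩ := h
  obtain ⟨hsu, rfl, -, hR⟩ := Finset.mem_filter.1 hs
  rw [Finset.mem_powerset] at hsu
  constructor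
  · rw [size_subconf, size_subconf]
    have h1 : u ⊆ s.biUnion fun x => insert x (X.neighbors x) := by
      intro y hy
      by_cases hys : y ∈ s
      · exact Finset.mem_biUnion.2 ⟨y, hys, Finset.mem_insert_self _ _⟩
      · obtain ⟨x, hx, c, -, hc⟩ := hR y hy hys
        exact Finset.mem_biUnion.2 ⟨x, hx, Finset.mem_insert_of_mem
          (mem_neighbors.2 (by rw [hc]; exact Option.some_ne_none c))⟩
    refine (Finset.card_le_card h1).trans (Finset.card_biUnion_le_card_mul _ _ _ fun x _ => ?_)
    exact (Finset.card_insert_le _ _).trans (Nat.succ_le_succ (X.card_neighbors_le x))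
  · refine X.connected_of_adjacent hS hsu fun y hy hys => ?_
    obtain ⟨x, hx, c, -, hc⟩ := hR y hy hys
    exact ⟨x, hx, by rw [hc]; exact Option.some_ne_none c⟩

theorem hullCoeff_ne_zero {D R : Set C} {S U : Conf C q} (hS : S.IsConnected)
    (h : hullCoeff D R S U ≠ 0) : U.size ≤ S.size * (q + 1) ∧ U.IsConnected := by
  have h1 := hullSubsets_nonempty U.rep hS (Finset.card_ne_zero.1 h)
  rwa [subconf_univ, conf_rep] at h1

/-- Subsets with a hull inside of `w` are counted by the hulls. -/
theorem sum_card_hullSubsets [Finite C] (X : ColoredGraph C q V) (D R : Set C) {S : Conf C q}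
    (hS : S.IsConnected) (w : Finset V) (σ : ℕ → ℝ) :
    ∑ u ∈ w.powerset, σ u.card * ((hullSubsets X D R S u).card : ℝ) =
      ∑ U ∈ connectedConfs C q (S.size * (q + 1)),
        (subCount X w U : ℝ) * (σ U.size * (hullCoeff D R S U : ℝ)) := by
  rw [← sum_subconf_eq X w (fun U => σ U.size * (hullCoeff D R S U : ℝ))]
  · refine Finset.sum_congr rfl fun u _ => ?_
    rw [card_hullSubsets, size_subconf]
  · intro u _ hu
    rw [mem_connectedConfs] at hu
    by_contra h
    exact hu (hullCoeff_ne_zero hS fun h0 => h (by rw [h0, Nat.cast_zero, mul_zero]))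

theorem kabiMap_eq_sum [Finite C] (f : ConfSeries C q) {T : Conf C q} (hT : T.IsConnected) :
    ConfSeries.kabiMap f T = ∑ U ∈ connectedConfs C q (T.size * (q + 1)),
      f U * ((-1) ^ (T.size + U.size) * (hullCoeff ∅ Set.univ T U : ℝ)) := by
  unfold ConfSeries.kabiMap
  change (∑ᶠ S : {S : Conf C q | S.IsConnected}, _) = _
  rw [finsum_set_coe_eq_finsum_mem (f := fun S : Conf C q =>
    (-1 : ℝ) ^ (T.size + S.size) * (kabiCoeff T S : ℝ) * f S),
    finsum_mem_eq_sum_of_inter_support_eq (t := connectedConfs C q (T.size * (q + 1)))]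
  · refine Finset.sum_congr rfl fun U _ => ?_
    rw [kabiCoeff_eq_hullCoeff]
    ring
  · ext U
    simp only [Set.mem_inter_iff, Set.mem_ofPred_eq, Function.mem_support, Finset.mem_coe,
      mem_connectedConfs]
    refine and_congr_left fun h => ⟨fun hU => ⟨?_, hU⟩, fun hU => hU.2⟩
    rw [kabiCoeff_eq_hullCoeff] at h
    exact (hullCoeff_ne_zero hT fun h0 => h (by rw [h0, Nat.cast_zero, mul_zero, zero_mul])).1

/-- The full subgraphs in the class `T` without outer neighbors in `w`. -/
def components (X : ColoredGraph C q V) (w : Finset V) (T : Conf C q) : Finset (Finset V) :=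
  w.powerset.filter fun s => X.subconf s = T ∧ ∀ x ∈ s, ∀ y ∈ w, y ∉ s → X.color x y = none

/-- The kabi map counts the connected components. -/
theorem sum_kabi [Finite C] (X : ColoredGraph C q V) (w : Finset V) {T : Conf C q}
    (hT : T.IsConnected) :
    ∑ U ∈ connectedConfs C q (T.size * (q + 1)),
      (subCount X w U : ℝ) * ((-1) ^ (T.size + U.size) * (hullCoeff ∅ Set.univ T U : ℝ)) =
      (components X w T).card := by
  rw [← sum_card_hullSubsets X ∅ Set.univ hT w (fun k => (-1) ^ (T.size + k))]
  have h1 : ∀ u ∈ w.powerset, (-1 : ℝ) ^ (T.size + u.card) *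
      ((hullSubsets X ∅ Set.univ T u).card : ℝ) =
      ∑ s ∈ w.powerset.filter (fun s => X.subconf s = T),
        if s ⊆ u ∧ ∀ y ∈ u, y ∉ s → ∃ x ∈ s, X.color x y ≠ none then
          (-1 : ℝ) ^ (T.size + u.card) else 0 := by
    intro u hu
    rw [Finset.mem_powerset] at hu
    rw [← Finset.sum_filter, Finset.sum_const, nsmul_eq_mul, mul_comm]
    congr 2
    unfold hullSubsets
    congr 1
    ext s
    simp only [Finset.mem_filter, Finset.mem_powerset, Set.mem_empty_iff_false, Set.mem_univ,
      IsEmpty.forall_iff, implies_true, true_and, Option.ne_none_iff_exists']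
    constructor
    · rintro ⟨h1, h2, h3⟩
      exact ⟨⟨h1.trans hu, h2⟩, h1, h3⟩
    · rintro ⟨⟨-, h2⟩, h1, h3⟩
      exact ⟨h1, h2, h3⟩
  rw [Finset.sum_congr rfl h1, Finset.sum_comm]
  have h2 : ∀ s ∈ w.powerset.filter (fun s => X.subconf s = T),
      (∑ u ∈ w.powerset, if s ⊆ u ∧ ∀ y ∈ u, y ∉ s → ∃ x ∈ s, X.color x y ≠ none then
          (-1 : ℝ) ^ (T.size + u.card) else 0) =
      if ∀ x ∈ s, ∀ y ∈ w, y ∉ s → X.color x y = none then 1 else 0 := by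
    intro s hs
    rw [Finset.mem_filter, Finset.mem_powerset] at hs
    obtain ⟨hsw, rfl⟩ := hs
    rw [← Finset.sum_filter]
    -- The admissible u are exactly s ∪ c with c a subset of the outer boundary b of s in w. Up to
    -- the even sign (-1)^(2#s) this leaves the alternating sum over subsets of b, which is 1 if b
    -- is empty and 0 otherwise.
    set b := w.filter fun y => y ∉ s ∧ ∃ x ∈ s, X.color x y ≠ none with hb
    have hbs : ∀ c ⊆ b, Disjoint s c := fun c hc =>
      Finset.disjoint_left.2 fun x hx hxc => (Finset.mem_filter.1 (hc hxc)).2.1 hx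
    have h3 : ∑ u ∈ w.powerset.filter (fun u => s ⊆ u ∧
        ∀ y ∈ u, y ∉ s → ∃ x ∈ s, X.color x y ≠ none),
          (-1 : ℝ) ^ ((X.subconf s).size + u.card) = ∑ c ∈ b.powerset, (-1 : ℝ) ^ c.card := by
      symm
      refine Finset.sum_nbij' (fun c => s ∪ c) (fun u => u \ s) ?_ ?_ ?_ ?_ ?_
      · intro c hc
        rw [Finset.mem_powerset] at hc
        rw [Finset.mem_filter, Finset.mem_powerset]
        refine ⟨Finset.union_subset hsw (hc.trans (Finset.filter_subset _ _)),
          Finset.subset_union_left, fun y hy hys => ?_⟩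
        exact (Finset.mem_filter.1 (hc ((Finset.mem_union.1 hy).resolve_left hys))).2.2
      · intro u hu
        rw [Finset.mem_filter, Finset.mem_powerset] at hu
        rw [Finset.mem_powerset]
        intro y hy
        rw [Finset.mem_sdiff] at hy
        exact Finset.mem_filter.2 ⟨hu.1 hy.1, hy.2, hu.2.2 y hy.1 hy.2⟩
      · intro c hc
        exact Finset.union_sdiff_cancel_left (hbs c (Finset.mem_powerset.1 hc))
      · intro u hu
        exact Finset.union_sdiff_of_subset (Finset.mem_filter.1 hu).2.1
      · intro c hc
        rw [Finset.card_union_of_disjoint (hbs c (Finset.mem_powerset.1 hc)), size_subconf,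
          ← add_assoc, pow_add, Even.neg_one_pow ⟨_, rfl⟩, one_mul]
    have h4 := congrArg (Int.cast : ℤ → ℝ) (Finset.sum_powerset_neg_one_pow_card (x := b))
    push_cast at h4
    rw [h3, h4]
    refine if_congr ?_ rfl rfl
    rw [hb, Finset.filter_eq_empty_iff]
    constructor
    · intro h x hx y hy hys
      by_contra hc
      exact h hy ⟨hys, x, hx, hc⟩
    · rintro h y hy ⟨hys, x, hx, hc⟩
      exact hc (h x hx y hy hys)
  rw [Finset.sum_congr rfl h2, ← Finset.sum_filter, Finset.sum_const, nsmul_eq_mul, mul_one,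
    Finset.filter_filter]
  rfl

/-- A nonempty proper subset of a connected graph has an edge leaving it, so it cannot be a
component. -/
theorem components_subset (X : ColoredGraph C q V) {w : Finset V} {T : Conf C q}
    (hw : (X.subconf w).IsConnected) (hT : T.IsConnected) : components X w T ⊆ {w} := by
  intro s hs
  obtain ⟨hsw, rfl, h⟩ := Finset.mem_filter.1 hs
  rw [Finset.mem_singleton]
  by_contra hne
  have hpos := hT.size_pos
  rw [size_subconf, Finset.card_pos] at hpos
  obtain ⟨x, hx, y, hy, hys, hxy⟩ :=
    X.exists_adjacent_of_connected hw (Finset.mem_powerset.1 hsw) hpos hne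
  exact hxy (h x hx y hy hys)

theorem self_mem_components (X : ColoredGraph C q V) (w : Finset V) :
    w ∈ components X w (X.subconf w) :=
  Finset.mem_filter.2 ⟨Finset.mem_powerset_self w, rfl, fun _ _ _ hy hy' => absurd hy hy'⟩

end Hull

/-! ### Sequences with finitely many accumulation points and a shift -/

section FiniteShift

theorem iterate_of_backward {A : Type*} {τ : A → A} {l : ℕ → A} {N : ℕ}
    (hl : ∀ n, N ≤ n → l n = τ (l (n + 1))) {n : ℕ} (hn : N ≤ n) (k : ℕ) :
    l n = τ^[k] (l (n + k)) := by
  induction k with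
  | zero => rfl
  | succ k ih => rw [ih, hl (n + k) (by omega), Function.iterate_succ_apply, add_assoc]

/-- Choose an occurrence of b, then a later occurrence of a, and walk back by τ. -/
theorem transitive_of_backward {A : Type*} {τ : A → A} {l : ℕ → A} {N : ℕ}
    (hl : ∀ n, N ≤ n → l n = τ (l (n + 1))) (hf : ∀ a M, ∃ n, M ≤ n ∧ l n = a) (a b : A) :
    ∃ k : ℕ, τ^[k] a = b := by
  obtain ⟨n, hn, rfl⟩ := hf b N
  obtain ⟨m, hm, rfl⟩ := hf a n
  obtain ⟨k, rfl⟩ := Nat.exists_eq_add_of_le hm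
  exact ⟨k, (iterate_of_backward hl hn k).symm⟩

theorem minimalPeriod_eq_of_transitive {A : Type*} {τ : A → A}
    (h : ∀ a b, ∃ k : ℕ, τ^[k] a = b) (a b : A) :
    0 < Function.minimalPeriod τ a ∧ Function.minimalPeriod τ a = Function.minimalPeriod τ b := by
  have hp : a ∈ Function.periodicPts τ := by
    obtain ⟨k, hk⟩ := h (τ a) a
    exact ⟨k + 1, k.succ_pos, hk⟩
  refine ⟨Function.minimalPeriod_pos_of_mem_periodicPts hp, ?_⟩
  obtain ⟨k, rfl⟩ := h a b
  exact (Function.minimalPeriod_apply_iterate hp k).symm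

theorem isRationalSubset_of_eventually_periodic {U : Set ℕ} {N h : ℕ} (hh : 0 < h)
    (hU : ∀ n, N ≤ n → (n + h ∈ U ↔ n ∈ U)) : IsRationalSubset U := by
  set f : PowerSeries ℂ := PowerSeries.mk fun n => if n ∈ U then (1 : ℂ) else 0 with hf
  set g : PowerSeries ℂ := (1 - PowerSeries.X ^ h) * f with hg
  -- Multiplication by 1 - X^h subtracts the shifted indicator series, so by periodicity nothing
  -- survives in degrees N + h and above.
  refine ⟨PowerSeries.trunc (N + h) g, 1 - Polynomial.X ^ h, ?_, ?_⟩
  · rw [Polynomial.coeff_sub, Polynomial.coeff_X_pow, if_neg hh.ne]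
    simp
  · have h1 : ((1 - Polynomial.X ^ h : Polynomial ℂ) : PowerSeries ℂ) * f = g := by
      rw [hg]; simp
    refine h1.trans ?_
    ext n
    rw [Polynomial.coeff_coe, PowerSeries.coeff_trunc]
    split_ifs with hn
    · rfl
    · obtain ⟨m, rfl⟩ := Nat.exists_eq_add_of_le (not_lt.1 hn)
      rw [hg, sub_mul, one_mul, map_sub, show N + h + m = (N + m) + h by ring,
        PowerSeries.coeff_X_pow_mul, hf, PowerSeries.coeff_mk, PowerSeries.coeff_mk, sub_eq_zero]
      exact if_congr (hU (N + m) (by omega)) rfl rfl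

theorem finiteRationalPartition_of_label {A : Type u} [Finite A] {U : A → Set ℕ} {l : ℕ → A}
    {N h : ℕ} (hh : 0 < h) (hU : ∀ n, N ≤ n → ∀ a, n ∈ U a ↔ l n = a)
    (hl : ∀ n k, N ≤ n → (l n = l (n + k) ↔ h ∣ k)) :
    IsFiniteRationalPartition U ∧ IsLeast {k | IsPeriodOfPartition U k} h := by
  refine ⟨⟨inferInstance, fun a => ?_, Set.Iio N, Set.finite_Iio N, ?_, ?_⟩,
    ⟨hh, Set.Iio N, Set.finite_Iio N, fun e => ?_⟩, ?_⟩
  · refine isRationalSubset_of_eventually_periodic (N := N) hh fun n hn => ?_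
    rw [hU n hn, hU (n + h) (by omega), (hl n h hn).2 dvd_rfl]
  · intro a b hab
    rw [Set.disjoint_left]
    rintro n ⟨hn1, hn2⟩ ⟨hn3, -⟩
    rw [Set.mem_Iio, not_lt] at hn2
    exact hab (((hU n hn2 a).1 hn1).symm.trans ((hU n hn2 b).1 hn3))
  · ext n
    simp only [Set.mem_iUnion, Set.mem_sdiff, Set.mem_compl_iff, Set.mem_Iio, not_lt]
    exact ⟨fun ⟨_, _, h⟩ => h, fun hn => ⟨l n, (hU n hn _).2 rfl, hn⟩⟩
  · have : NeZero h := ⟨hh.ne'⟩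
    have hlt := e.val_lt
    -- N h + e is a reference index in the class of e that is at least N; the label there serves the
    -- whole class.
    have key : ∀ n, N ≤ n → (n : ZMod h) = e → l n = l (N * h + e.val) := by
      intro n hn hne
      have h1 : N ≤ N * h + e.val := le_add_right (Nat.le_mul_of_pos_right N hh)
      have h2 : ((N * h + e.val : ℕ) : ZMod h) = (n : ZMod h) := by
        push_cast
        rw [ZMod.natCast_self, mul_zero, zero_add, ZMod.natCast_val, ZMod.cast_id, hne]
      rcases le_total n (N * h + e.val) with h3 | h3
      · obtain ⟨k, hk⟩ := Nat.exists_eq_add_of_le h3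
        rw [hk, hl n k hn]
        rw [hk, Nat.cast_add, add_eq_left] at h2
        exact (ZMod.natCast_eq_zero_iff k h).1 h2
      · obtain ⟨k, hk⟩ := Nat.exists_eq_add_of_le h3
        rw [hk, eq_comm, hl _ k h1]
        rw [hk, Nat.cast_add _ k, eq_comm, add_eq_left] at h2
        exact (ZMod.natCast_eq_zero_iff k h).1 h2
    refine ⟨l (N * h + e.val), ?_⟩
    rintro n ⟨hn1, hn2⟩
    rw [Set.mem_Iio, not_lt] at hn2
    exact (hU n hn2 _).2 (key n hn2 hn1)
  · rintro k ⟨hk, D, hD, hDk⟩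
    obtain ⟨M, hM⟩ := hD.bddAbove
    -- Both n and n + k lie beyond N and the exceptional set, in one class modulo k; equal labels
    -- then force h to divide k.
    set n := max N (M + 1) with hn
    have hN : N ≤ n := le_max_left _ _
    have hM' : M < n := (Nat.lt_succ_self M).trans_le (le_max_right N (M + 1))
    obtain ⟨a, ha⟩ := hDk (n : ZMod k)
    have h1 : n ∈ U a := ha ⟨rfl, fun h => by have := hM h; omega⟩
    have h2 : n + k ∈ U a := ha ⟨by simp, fun h => by have := hM h; omega⟩
    rw [hU n hN] at h1
    rw [hU (n + k) (by omega)] at h2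
    exact Nat.le_of_dvd hk ((hl n k hN).1 (h1.trans h2.symm))

/-- A sequence in a compact set with finitely many accumulation points, on which the shift acts,
is eventually periodic up to small perturbations. -/
theorem finite_shift {E : Type u} [TopologicalSpace E] [T2Space E] [FirstCountableTopology E]
    {X : ℕ → E} {K A : Set E} (hK : IsCompact K) (hX : ∀ n, X n ∈ K) (hfin : A.Finite)
    (hA : ∀ a, a ∈ A ↔ MapClusterPt a atTop X) (τ : A → A)
    (hτ : ∀ (a : A) (n : ℕ → ℕ), StrictMono n → Tendsto (fun m => X (n m)) atTop (𝓝 a.1) →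
      Tendsto (fun m => X (n m - 1)) atTop (𝓝 (τ a).1)) :
    ∃ h : ℕ, 0 < h ∧ IsFiniteRationallyAccumulating X A h ∧
      (∀ a b : A, ∃ k : ℕ, τ^[k] a = b) ∧ (∀ a : A, Function.minimalPeriod τ a = h) ∧
        Function.Bijective τ := by
  have : Finite A := hfin
  obtain ⟨a₀, ha₀⟩ : A.Nonempty := by
    obtain ⟨a, -, ha⟩ := hK.exists_mapClusterPt_of_frequently
      (Frequently.of_forall hX : ∃ᶠ n in atTop, X n ∈ K)
    exact ⟨a, (hA a).2 ha⟩
  have label : ∀ V : A → Set E, (∀ a, IsOpen (V a)) → (∀ a : A, (a : E) ∈ V a) →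
      Pairwise (fun a b => Disjoint (V a) (V b)) → ∃ (l : ℕ → A) (N : ℕ),
        (∀ n, N ≤ n → ∀ a, X n ∈ V a ↔ l n = a) ∧ (∀ n, N ≤ n → l n = τ (l (n + 1))) ∧
          ∀ a M, ∃ n, M ≤ n ∧ l n = a := by
    intro V hV hmem hdisj
    -- Terms outside all the neighborhoods for infinitely many indices would accumulate, by
    -- compactness, at a point outside A.
    have hev : ∀ᶠ n in atTop, ∃ a, X n ∈ V a := by
      by_contra hne
      have hfr : ∃ᶠ n in atTop, X n ∈ K \ ⋃ a, V a := by
        refine (not_eventually.1 hne).mono fun n hn => ⟨hX n, ?_⟩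
        simpa using hn
      obtain ⟨x, hx, hxc⟩ := (hK.diff (isOpen_iUnion hV)).exists_mapClusterPt_of_frequently hfr
      exact hx.2 (Set.mem_iUnion.2 ⟨⟨x, (hA x).2 hxc⟩, hmem _⟩)
    -- If this failed infinitely often, a convergent subsequence of the failures would have limit a,
    -- the only accumulation point compatible with V a; the hypothesis on τ then puts the preceding
    -- terms into V (τ a).
    have hshift : ∀ a : A, ∀ᶠ n in atTop, X n ∈ V a → X (n - 1) ∈ V (τ a) := by
      intro a
      by_contra hne
      obtain ⟨φ, hφ, hφa⟩ := extraction_of_frequently_atTop (not_eventually.1 hne)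
      push Not at hφa
      obtain ⟨x, -, ψ, hψ, hx⟩ := hK.tendsto_subseq (fun n => hX (φ n))
      have hcl : MapClusterPt x atTop X :=
        MapClusterPt.of_comp (hφ.comp hψ).tendsto_atTop hx.mapClusterPt
      set b : A := ⟨x, (hA x).2 hcl⟩ with hb
      have hab : b = a := by
        by_contra hab
        obtain ⟨m, hm⟩ := (hx.eventually ((hV b).mem_nhds (hmem b))).exists
        exact Set.disjoint_left.1 (hdisj hab) hm (hφa (ψ m)).1
      have h1 := hτ b (φ ∘ ψ) (hφ.comp hψ) hx
      rw [hab] at h1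
      obtain ⟨m, hm⟩ := (h1.eventually ((hV (τ a)).mem_nhds (hmem (τ a)))).exists
      exact (hφa (ψ m)).2 hm
    -- Finiteness of A provides one threshold for all labels.
    obtain ⟨N, hN⟩ := eventually_atTop.1 (hev.and (eventually_all.2 hshift))
    have huniq : ∀ n a b, X n ∈ V a → X n ∈ V b → a = b := by
      intro n a b ha hb
      by_contra hab
      exact Set.disjoint_left.1 (hdisj hab) ha hb
    let l : ℕ → A := fun n => if h : ∃ a, X n ∈ V a then h.choose else ⟨a₀, ha₀⟩
    have hl : ∀ n, N ≤ n → X n ∈ V (l n) := by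
      intro n hn
      have h := (hN n hn).1
      simp only [l, dif_pos h]
      exact h.choose_spec
    have hl' : ∀ n, N ≤ n → ∀ a, X n ∈ V a ↔ l n = a := fun n hn a =>
      ⟨fun h => huniq n _ _ (hl n hn) h, fun h => h ▸ hl n hn⟩
    refine ⟨l, N, hl', fun n hn => ?_, fun a M => ?_⟩
    · rw [← hl' n hn]
      exact (hN (n + 1) (by omega)).2 _ (hl (n + 1) (by omega))
    · have hfr := ((hA a).1 a.2).frequently ((hV a).mem_nhds (hmem a))
      obtain ⟨n, hn, hna⟩ := frequently_atTop.1 hfr (max M N)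
      exact ⟨n, (le_max_left _ _).trans hn, (hl' n ((le_max_right _ _).trans hn) a).1 hna⟩
  -- The dynamics of τ does not depend on the neighborhoods, so it is read off from one separating
  -- family; the accumulation statement is then checked for arbitrary families.
  obtain ⟨U, hU, hUd⟩ := hfin.t2_separation
  obtain ⟨l, N, -, hl, hf⟩ := label (fun a => U a) (fun a => (hU a).2) (fun a => (hU a).1)
    (fun a b hab => hUd a.2 b.2 fun h => hab (Subtype.ext h))
  have htr := transitive_of_backward hl hf
  have hper := minimalPeriod_eq_of_transitive htr
  have hpos := (hper ⟨a₀, ha₀⟩ ⟨a₀, ha₀⟩).1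
  have hsurj : Function.Surjective τ := by
    intro a
    obtain ⟨n, hn, rfl⟩ := hf a N
    exact ⟨_, (hl n hn).symm⟩
  refine ⟨Function.minimalPeriod τ ⟨a₀, ha₀⟩, hpos, ⟨hfin, hA, ?_⟩, htr, fun a => (hper a _).2,
    Finite.surjective_iff_bijective.1 hsurj⟩
  intro V hV hmem hdisj
  obtain ⟨l, N, hl, hτl, -⟩ := label V hV hmem hdisj
  refine finiteRationalPartition_of_label hpos hl fun n k hn => ?_
  -- Since l(n) = τ^k(l(n+k)), equality of the two labels says that k is a period of l(n+k), i.e. a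
  -- multiple of the cycle length.
  rw [← (hper (l (n + k)) ⟨a₀, ha₀⟩).2, ← Function.isPeriodicPt_iff_minimalPeriod_dvd,
    iterate_of_backward hτl hn k]
  rfl

end FiniteShift

/-! ### Balls in the Cayley graph -/

section CayleyBalls

variable {Γ : Type u} [CancelMonoid Γ] (G : GenSystem Γ)

theorem exists_word (x : Γ) :
    ∃ l : List Γ, l.length = length G x ∧ (∀ g ∈ l, g ∈ G.carrier) ∧ l.prod = x := by
  have hne : {n | ∃ l : List Γ, l.length = n ∧ (∀ g ∈ l, g ∈ G.carrier) ∧ l.prod = x}.Nonempty := by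
    have hx : x ∈ Submonoid.closure (G.carrier : Set Γ) := by
      rw [G.closure_eq_top]; exact Submonoid.mem_top x
    obtain ⟨l, hl, hp⟩ := Submonoid.exists_list_of_mem_closure hx
    exact ⟨l.length, l, rfl, fun g hg => hl g hg, hp⟩
  exact Nat.sInf_mem hne

theorem length_le_of_word {l : List Γ} (hl : ∀ g ∈ l, g ∈ G.carrier) :
    length G l.prod ≤ l.length :=
  Nat.sInf_le ⟨l, rfl, hl, rfl⟩

theorem length_one : length G (1 : Γ) = 0 :=
  Nat.le_zero.1 (length_le_of_word G (l := []) (by simp))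

theorem length_mul_le (x : Γ) {g : Γ} (hg : g ∈ G.carrier) :
    length G (x * g) ≤ length G x + 1 := by
  obtain ⟨l, h1, h2, h3⟩ := exists_word G x
  have h := length_le_of_word G (l := l ++ [g]) (by
    intro k hk
    rcases List.mem_append.1 hk with hk | hk
    · exact h2 k hk
    · rwa [List.mem_singleton.1 hk])
  rw [List.prod_append, h3, List.prod_singleton, List.length_append, h1] at h
  exact h

/-- Removing the last letter of a shortest word leaves a shortest word. -/
theorem exists_eq_mul_of_ne_one {x : Γ} (hx : x ≠ 1) :
    ∃ y, ∃ g ∈ G.carrier, x = y * g ∧ length G y + 1 = length G x := by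
  obtain ⟨l, h1, h2, h3⟩ := exists_word G x
  rcases l.eq_nil_or_concat with rfl | ⟨k, g, rfl⟩
  · exact absurd h3.symm hx
  · rw [List.concat_eq_append] at h1 h2 h3
    have hg : g ∈ G.carrier := h2 g (by simp)
    have hk := length_le_of_word G (l := k) fun a ha => h2 a (List.mem_append_left _ ha)
    rw [List.prod_append, List.prod_singleton] at h3
    rw [List.length_append, List.length_singleton] at h1
    have h4 := length_mul_le G k.prod hg
    rw [h3] at h4
    exact ⟨k.prod, g, hg, h3.symm, by omega⟩

/-- The union of a set and its right translates by the generators. -/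
def rightHull (s : Finset Γ) : Finset Γ := s.biUnion fun x => insert x (G.carrier.image (x * ·))

theorem mem_rightHull {s : Finset Γ} {y : Γ} :
    y ∈ rightHull G s ↔ ∃ x ∈ s, y = x ∨ ∃ g ∈ G.carrier, x * g = y := by
  simp [rightHull]

theorem subset_rightHull (s : Finset Γ) : s ⊆ rightHull G s :=
  fun x hx => (mem_rightHull G).2 ⟨x, hx, Or.inl rfl⟩

theorem card_rightHull_le (s : Finset Γ) :
    (rightHull G s).card ≤ s.card * (G.carrier.card + 1) :=
  Finset.card_biUnion_le_card_mul _ _ _ fun _ _ =>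
    (Finset.card_insert_le _ _).trans (Nat.succ_le_succ Finset.card_image_le)

theorem ball_succ_subset {n : ℕ} {s : Finset Γ} (hs : (s : Set Γ) = ball G n) :
    ball G (n + 1) ⊆ rightHull G s := by
  intro x hx
  change length G x ≤ n + 1 at hx
  rw [Finset.mem_coe, mem_rightHull]
  have hmem : ∀ y, y ∈ s ↔ length G y ≤ n := fun y => by
    rw [← Finset.mem_coe, hs]; rfl
  by_cases h1 : x = 1
  · subst h1
    exact ⟨1, (hmem 1).2 (by rw [length_one]; omega), Or.inl rfl⟩
  · obtain ⟨y, g, hg, rfl, hy⟩ := exists_eq_mul_of_ne_one G h1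
    exact ⟨y, (hmem y).2 (by omega), Or.inr ⟨g, hg, rfl⟩⟩

theorem finite_ball (n : ℕ) : (ball G n).Finite := by
  induction n with
  | zero =>
    refine (Set.finite_singleton (1 : Γ)).subset fun x hx => ?_
    by_contra h1
    obtain ⟨y, g, -, -, hy⟩ := exists_eq_mul_of_ne_one G h1
    change length G x ≤ 0 at hx
    omega
  | succ n ih =>
    have h : ((ih.toFinset : Finset Γ) : Set Γ) = ball G n := by simp
    exact (rightHull G ih.toFinset).finite_toSet.subset (ball_succ_subset G h)

/-- The ball of radius `n` as a finset. -/
def finBall (n : ℕ) : Finset Γ := (finite_ball G n).toFinset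

theorem mem_finBall {n : ℕ} {x : Γ} : x ∈ finBall G n ↔ length G x ≤ n := by
  rw [finBall, Set.Finite.mem_toFinset]; rfl

theorem coe_finBall (n : ℕ) : (finBall G n : Set Γ) = ball G n := by simp [finBall]

theorem one_mem_finBall (n : ℕ) : (1 : Γ) ∈ finBall G n := by
  rw [mem_finBall, length_one]; omega

theorem card_finBall_pos (n : ℕ) : 0 < (finBall G n).card :=
  Finset.card_pos.2 ⟨1, one_mem_finBall G n⟩

theorem card_finBall_succ_le (n : ℕ) :
    (finBall G (n + 1)).card ≤ (finBall G n).card * (G.carrier.card + 1) := by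
  refine (Finset.card_le_card ?_).trans (card_rightHull_le G (finBall G n))
  rw [← Finset.coe_subset, coe_finBall]
  exact ball_succ_subset G (coe_finBall G n)

theorem finBall_mono {m n : ℕ} (h : m ≤ n) : finBall G m ⊆ finBall G n := by
  intro x hx
  rw [mem_finBall] at hx ⊢
  omega

theorem tendsto_card_finBall [Infinite Γ] :
    Tendsto (fun n => (finBall G n).card) atTop atTop := by
  refine tendsto_atTop_atTop_of_monotone (fun m n h => Finset.card_le_card (finBall_mono G h)) ?_
  intro k
  obtain ⟨s, hs⟩ := Infinite.exists_subset_card_eq Γ k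
  refine ⟨s.sup (length G), ?_⟩
  rw [← hs]
  refine Finset.card_le_card fun x hx => ?_
  rw [mem_finBall]
  exact Finset.le_sup (f := length G) hx

theorem cayleyGraph_color_out {x y g : Γ} (hg : g ∈ G.carrier) :
    (cayleyGraph G).color x y = some (Quot.mk _ (Sum.inl ⟨g, hg⟩)) ↔ y = x * g :=
  cayleyColorFun_eq_some G

/-- The prefixes of a shortest word for x lie in the ball and join 1 to x. -/
theorem isConnected_finBall (n : ℕ) : ((cayleyGraph G).subconf (finBall G n)).IsConnected := by
  rw [isConnected_subconf, SimpleGraph.connected_iff_exists_forall_reachable]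
  refine ⟨⟨1, one_mem_finBall G n⟩, ?_⟩
  have key : ∀ k (x : Γ) (hx : x ∈ finBall G n), length G x = k →
      ((cayleyGraph G).induce (finBall G n : Set Γ)).toSimpleGraph.Reachable
        ⟨1, one_mem_finBall G n⟩ ⟨x, hx⟩ := by
    intro k
    induction k with
    | zero =>
      intro x hx hk
      by_cases h1 : x = 1
      · subst h1
        exact SimpleGraph.Reachable.refl _
      · obtain ⟨y, g, -, -, hy⟩ := exists_eq_mul_of_ne_one G h1
        omega
    | succ k ih =>
      intro x hx hk
      have h1 : x ≠ 1 := by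
        rintro rfl
        rw [length_one] at hk
        omega
      obtain ⟨y, g, hg, hxy, hy⟩ := exists_eq_mul_of_ne_one G h1
      have hyB : y ∈ finBall G n := by
        rw [mem_finBall] at hx ⊢
        omega
      have hadj : ((cayleyGraph G).induce (finBall G n : Set Γ)).toSimpleGraph.Adj
          ⟨y, hyB⟩ ⟨x, hx⟩ := by
        change (cayleyGraph G).color y x ≠ none
        rw [(cayleyGraph_color_out G hg).2 hxy]
        exact Option.some_ne_none _
      exact (ih y hyB (by omega)).trans hadj.reachable
  rintro ⟨x, hx⟩
  exact key _ x hx rfl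

end CayleyBalls

/-! ### Free energies, compactness and the description of Ω -/

section FreeEnergy

variable {Γ : Type u} [CancelMonoid Γ] (G : GenSystem Γ)

theorem freeEnergy_eq (n : ℕ) (S : Conf (CayleyColor G) (Nat.card (CayleyColor G))) :
    freeEnergy G n S = logGrowth (cayleyGraph G) (finBall G n) S / (finBall G n).card := by
  unfold freeEnergy
  have : Fintype (ball G n) := (finite_ball G n).fintype
  have hc : (ball G n).ncard = (finBall G n).card := by
    rw [← coe_finBall, Set.ncard_coe_finset]
  rw [logGrowthFunction_eq, hc]
  congr 1
  unfold logGrowth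
  have h : (Finset.univ : Finset (ball G n)).map
      (Function.Embedding.subtype (fun x => x ∈ ball G n)) = finBall G n := by
    ext x
    rw [Finset.mem_map]
    exact ⟨fun ⟨y, _, hy⟩ => hy ▸ (mem_finBall G).2 y.2,
      fun hx => ⟨⟨x, (mem_finBall G).1 hx⟩, Finset.mem_univ _, rfl⟩⟩
  rw [← h, ← growthElement_comap]
  rfl

theorem freeEnergy_of_isConnected (n : ℕ) {S : Conf (CayleyColor G) (Nat.card (CayleyColor G))}
    (hS : S.IsConnected) :
    freeEnergy G n S = subCount (cayleyGraph G) (finBall G n) S / (finBall G n).card := by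
  rw [freeEnergy_eq, logGrowth_of_isConnected _ _ hS]

/-- Reduces boundedness and convergence of all coefficients to those at connected configurations. -/
theorem freeEnergy_eq_sum (n : ℕ) (S : Conf (CayleyColor G) (Nat.card (CayleyColor G))) :
    freeEnergy G n S =
      ∑ U ∈ connectedConfs (CayleyColor G) (Nat.card (CayleyColor G)) S.size,
        freeEnergy G n U * lieCoeff S U := by
  rw [freeEnergy_eq, logGrowth_eq_sum, Finset.sum_div]
  refine Finset.sum_congr rfl fun U hU => ?_
  rw [freeEnergy_of_isConnected G n (mem_connectedConfs.1 hU).2]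
  ring

theorem abs_freeEnergy_le (n : ℕ) (S : Conf (CayleyColor G) (Nat.card (CayleyColor G))) :
    |freeEnergy G n S| ≤
      ∑ U ∈ connectedConfs (CayleyColor G) (Nat.card (CayleyColor G)) S.size,
        ((2 ^ (Nat.card (CayleyColor G) + 1) ^ U.size : ℕ) : ℝ) * |lieCoeff S U| := by
  rw [freeEnergy_eq_sum]
  refine (Finset.abs_sum_le_sum_abs _ _).trans (Finset.sum_le_sum fun U hU => ?_)
  have hc := (mem_connectedConfs.1 hU).2
  rw [abs_mul, freeEnergy_of_isConnected G n hc, abs_of_nonneg (by positivity)]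
  refine mul_le_mul_of_nonneg_right ?_ (abs_nonneg _)
  have hpos : (0 : ℝ) < (finBall G n).card := by exact_mod_cast card_finBall_pos G n
  rw [div_le_iff₀ hpos, mul_comm]
  exact_mod_cast subCount_le (cayleyGraph G) (finBall G n) hc

theorem exists_compact_freeEnergy :
    ∃ K : Set (ConfSeries (CayleyColor G) (Nat.card (CayleyColor G))),
      IsCompact K ∧ ∀ n, freeEnergy G n ∈ K :=
  ⟨Set.pi Set.univ fun _ => Set.Icc (-_) _, isCompact_univ_pi fun _ => isCompact_Icc,
    fun n _ _ => abs_le.1 (abs_freeEnergy_le G n _)⟩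

theorem kabiMap_freeEnergy (n : ℕ) {T : Conf (CayleyColor G) (Nat.card (CayleyColor G))}
    (hT : T.IsConnected) :
    ConfSeries.kabiMap (freeEnergy G n) T =
      ((components (cayleyGraph G) (finBall G n) T).card : ℝ) / (finBall G n).card := by
  rw [kabiMap_eq_sum _ hT, ← sum_kabi _ _ hT, Finset.sum_div]
  refine Finset.sum_congr rfl fun U hU => ?_
  rw [freeEnergy_of_isConnected G n (mem_connectedConfs.1 hU).2]
  ring

/-- The ball is a component of itself, so its own class has a nonzero kabi coefficient. -/
theorem freeEnergy_notMem_lieAtInfinity (n : ℕ) :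
    freeEnergy G n ∉
      ConfSeries.lieAtInfinity (CayleyColor G) (Nat.card (CayleyColor G)) := by
  rintro ⟨-, h⟩
  have h1 := h _ (isConnected_finBall G n)
  have hpos : (0 : ℝ) < (finBall G n).card := by exact_mod_cast card_finBall_pos G n
  rw [kabiMap_freeEnergy G n (isConnected_finBall G n), div_eq_zero_iff] at h1
  refine Finset.ne_empty_of_mem (self_mem_components (cayleyGraph G) (finBall G n)) ?_
  rw [← Finset.card_eq_zero]
  exact_mod_cast h1.resolve_right hpos.ne'

theorem mem_lieAtInfinity_of_tendsto [Infinite Γ] {n : ℕ → ℕ} (hn : Tendsto n atTop atTop)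
    {ω : ConfSeries (CayleyColor G) (Nat.card (CayleyColor G))}
    (h : Tendsto (fun m => freeEnergy G (n m)) atTop (𝓝 ω)) :
    ω ∈ ConfSeries.lieAtInfinity (CayleyColor G) (Nat.card (CayleyColor G)) := by
  constructor
  · refine isClosed_isLieLike.mem_of_tendsto h (Eventually.of_forall fun m => ?_)
    have h1 := isLieLike_logGrowth (cayleyGraph G) (finBall G (n m))
      ((finBall G (n m)).card : ℝ)⁻¹
    have h2 : freeEnergy G (n m) = fun S => ((finBall G (n m)).card : ℝ)⁻¹ *
        logGrowth (cayleyGraph G) (finBall G (n m)) S := by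
      funext S
      rw [freeEnergy_eq, div_eq_inv_mul]
    rw [Set.mem_ofPred_eq, h2]
    exact h1
  · intro T hT
    have h1 : Tendsto (fun m => ConfSeries.kabiMap (freeEnergy G (n m)) T) atTop
        (𝓝 (ConfSeries.kabiMap ω T)) := by
      simp only [kabiMap_eq_sum _ hT]
      refine tendsto_finsetSum _ fun U _ => ?_
      exact (tendsto_pi_nhds.1 h U).mul_const _
    refine tendsto_nhds_unique h1 ?_
    -- The ball has at most one component in the class T, so the kabi coefficient at T is at most
    -- 1/#Γ_n.
    have h2 : Tendsto (fun m => ((finBall G (n m)).card : ℝ)⁻¹) atTop (𝓝 0) :=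
      tendsto_inv_atTop_zero.comp
        (tendsto_natCast_atTop_atTop.comp ((tendsto_card_finBall G).comp hn))
    refine squeeze_zero (fun m => ?_) (fun m => ?_) h2
    · rw [kabiMap_freeEnergy G _ hT]
      positivity
    · rw [kabiMap_freeEnergy G _ hT, div_eq_mul_inv]
      refine mul_le_of_le_one_left (by positivity) ?_
      have h3 := Finset.card_le_card
        (components_subset (cayleyGraph G) (isConnected_finBall G (n m)) hT)
      rw [Finset.card_singleton] at h3
      exact_mod_cast h3

theorem mem_Omega_iff [Infinite Γ]
    (ω : ConfSeries (CayleyColor G) (Nat.card (CayleyColor G))) :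
    ω ∈ Omega G ↔ MapClusterPt ω atTop (freeEnergy G) := by
  constructor
  · rintro ⟨h1, h2⟩
    rw [mapClusterPt_iff_frequently]
    intro s hs
    rw [frequently_atTop]
    intro N
    -- ω differs from every free energy, so the first N of them can be removed from any
    -- neighborhood; thus membership in the closure already gives accumulation.
    have hfin : (freeEnergy G '' Set.Iio N).Finite := (Set.finite_Iio N).image _
    have hmem : ω ∈ (freeEnergy G '' Set.Iio N)ᶜ := by
      rintro ⟨n, -, rfl⟩
      exact freeEnergy_notMem_lieAtInfinity G n h1
    obtain ⟨_, ⟨hs', hc⟩, n, rfl⟩ := mem_closure_iff_nhds.1 h2 _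
      (inter_mem hs (hfin.isClosed.isOpen_compl.mem_nhds hmem))
    refine ⟨n, ?_, hs'⟩
    by_contra! hlt
    exact hc ⟨n, hlt, rfl⟩
  · intro h
    obtain ⟨φ, hφ, hω⟩ := MapClusterPt.tendsto_subseq h
    refine ⟨mem_lieAtInfinity_of_tendsto G hφ.tendsto_atTop hω, ?_⟩
    exact mem_closure_of_tendsto hω (Eventually.of_forall fun m => ⟨_, rfl⟩)

end FreeEnergy

/-! ### Dead elements and the shift on Ω -/

section Shift

variable {Γ : Type u} [CancelMonoid Γ] (G : GenSystem Γ)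

/-- The colors of the generators. -/
def outColors : Set (CayleyColor G) := Set.range fun g : G.carrier => Quot.mk _ (Sum.inl g)

/-- Saturation puts every x g into u, and the joining condition excludes anything else. So the hull
of s is unique, and copies with hull inside a ball can be counted by the classes of their hulls. -/
theorem mem_hullSubsets_cayleyGraph {S : Conf (CayleyColor G) (Nat.card (CayleyColor G))}
    {s u : Finset Γ} :
    s ∈ hullSubsets (cayleyGraph G) (outColors G) (outColors G) S u ↔
      (cayleyGraph G).subconf s = S ∧ rightHull G s = u := by
  unfold hullSubsets
  rw [Finset.mem_filter, Finset.mem_powerset]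
  constructor
  · rintro ⟨hsu, hS, h1, h2⟩
    refine ⟨hS, Finset.Subset.antisymm ?_ ?_⟩
    · intro y hy
      obtain ⟨x, hx, rfl | ⟨g, hg, rfl⟩⟩ := (mem_rightHull G).1 hy
      · exact hsu hx
      · obtain ⟨y, hy, hc⟩ := h1 x hx _ ⟨⟨g, hg⟩, rfl⟩
        rwa [← (cayleyGraph_color_out G hg).1 hc]
    · intro y hy
      rw [mem_rightHull]
      by_cases hys : y ∈ s
      · exact ⟨y, hys, Or.inl rfl⟩
      · obtain ⟨x, hx, _, ⟨⟨g, hg⟩, rfl⟩, hc⟩ := h2 y hy hys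
        exact ⟨x, hx, Or.inr ⟨g, hg, ((cayleyGraph_color_out G hg).1 hc).symm⟩⟩
  · rintro ⟨hS, rfl⟩
    refine ⟨subset_rightHull G s, hS, ?_, fun y hy hys => ?_⟩
    · rintro x hx _ ⟨⟨g, hg⟩, rfl⟩
      refine ⟨x * g, ?_, (cayleyGraph_color_out G hg).2 rfl⟩
      exact (mem_rightHull G).2 ⟨x, hx, Or.inr ⟨g, hg, rfl⟩⟩
    · obtain ⟨x, hx, rfl | ⟨g, hg, rfl⟩⟩ := (mem_rightHull G).1 hy
      · exact absurd hx hys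
      · exact ⟨x, hx, _, ⟨⟨g, hg⟩, rfl⟩, (cayleyGraph_color_out G hg).2 rfl⟩

/-- The linear functional which counts the subgraphs in the class `S` whose right translates by
the generators are contained in the graph. -/
def innerCount (f : ConfSeries (CayleyColor G) (Nat.card (CayleyColor G)))
    (S : Conf (CayleyColor G) (Nat.card (CayleyColor G))) : ℝ :=
  ∑ U ∈ connectedConfs (CayleyColor G) (Nat.card (CayleyColor G))
      (S.size * (Nat.card (CayleyColor G) + 1)),
    f U * (hullCoeff (outColors G) (outColors G) S U : ℝ)

theorem innerCount_freeEnergy (n : ℕ) {S : Conf (CayleyColor G) (Nat.card (CayleyColor G))}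
    (hS : S.IsConnected) :
    innerCount G (freeEnergy G n) S =
      (((finBall G n).powerset.filter fun s => (cayleyGraph G).subconf s = S ∧
        rightHull G s ⊆ finBall G n).card : ℝ) / (finBall G n).card := by
  have h1 := sum_card_hullSubsets (cayleyGraph G) (outColors G) (outColors G) hS (finBall G n)
    (fun _ => 1)
  simp only [one_mul] at h1
  have h2 : innerCount G (freeEnergy G n) S =
      (∑ u ∈ (finBall G n).powerset,
        ((hullSubsets (cayleyGraph G) (outColors G) (outColors G) S u).card : ℝ)) /
          (finBall G n).card := by
    rw [h1, innerCount, Finset.sum_div]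
    refine Finset.sum_congr rfl fun U hU => ?_
    rw [freeEnergy_of_isConnected G n (mem_connectedConfs.1 hU).2]
    ring
  rw [h2]
  congr 1
  -- Copies are grouped by their right hull u.
  rw [Finset.card_eq_sum_card_fiberwise (f := rightHull G) (t := (finBall G n).powerset)]
  · push_cast
    refine Finset.sum_congr rfl fun u hu => ?_
    rw [Finset.mem_powerset] at hu
    congr 2
    ext s
    rw [mem_hullSubsets_cayleyGraph, Finset.mem_filter, Finset.mem_filter, Finset.mem_powerset]
    constructor
    · rintro ⟨h1, rfl⟩
      exact ⟨⟨(subset_rightHull G s).trans hu, h1, hu⟩, rfl⟩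
    · rintro ⟨⟨-, h1, -⟩, h2⟩
      exact ⟨h1, h2⟩
  · intro s hs
    exact Finset.mem_powerset.2 (Finset.mem_filter.1 hs).2.2

/-- The dead elements of a ball. -/
def deadBall (n : ℕ) : Finset Γ := (finBall G n).filter (· ∈ deadElements G)

theorem abs_innerCount_sub_le (n : ℕ) {S : Conf (CayleyColor G) (Nat.card (CayleyColor G))}
    (hS : S.IsConnected) :
    |innerCount G (freeEnergy G (n + 1)) S -
        (subCount (cayleyGraph G) (finBall G n) S : ℝ) / (finBall G (n + 1)).card| ≤
      ((deadBall G (n + 1)).card : ℝ) / (finBall G (n + 1)).card *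
        ((2 ^ (Nat.card (CayleyColor G) + 1) ^ S.size : ℕ) : ℝ) := by
  rw [innerCount_freeEnergy G _ hS, ← sub_div, div_mul_eq_mul_div, abs_div, Nat.abs_cast]
  refine div_le_div_of_nonneg_right ?_ (Nat.cast_nonneg _)
  set P := (finBall G (n + 1)).powerset.filter fun s => (cayleyGraph G).subconf s = S ∧
        rightHull G s ⊆ finBall G (n + 1) with hP
  set Q := (finBall G n).powerset.filter fun s => (cayleyGraph G).subconf s = S with hQ
  change |(P.card : ℝ) - (Q.card : ℝ)| ≤ _
  have hmul : ∀ x ∈ finBall G n, ∀ g ∈ G.carrier, x * g ∈ finBall G (n + 1) := by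
    intro x hx g hg
    rw [mem_finBall] at hx ⊢
    exact (length_mul_le G x hg).trans (by omega)
  have hQP : Q ⊆ P := by
    intro s hs
    obtain ⟨hs1, hs2⟩ := Finset.mem_filter.1 hs
    rw [Finset.mem_powerset] at hs1
    refine Finset.mem_filter.2 ⟨Finset.mem_powerset.2
      (hs1.trans (finBall_mono G n.le_succ)), hs2, fun y hy => ?_⟩
    obtain ⟨x, hx, rfl | ⟨g, hg, rfl⟩⟩ := (mem_rightHull G).1 hy
    · exact finBall_mono G n.le_succ (hs1 hx)
    · exact hmul x (hs1 hx) g hg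
  rw [abs_of_nonneg (sub_nonneg.2 (by exact_mod_cast Finset.card_le_card hQP))]
  -- A copy in P but not in Q has a vertex x of length exactly n + 1. All x g still lie in the ball
  -- of radius n + 1, so x is dead.
  have hPQ : P \ Q ⊆ (finBall G (n + 1)).powerset.filter fun s =>
      (cayleyGraph G).subconf s = S ∧ ∃ x ∈ s, x ∈ deadBall G (n + 1) := by
    intro s hs
    obtain ⟨hs1, hs2⟩ := Finset.mem_sdiff.1 hs
    obtain ⟨hs3, hs4, hs5⟩ := Finset.mem_filter.1 hs1
    refine Finset.mem_filter.2 ⟨hs3, hs4, ?_⟩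
    have hn : ¬ s ⊆ finBall G n := fun h =>
      hs2 (Finset.mem_filter.2 ⟨Finset.mem_powerset.2 h, hs4⟩)
    obtain ⟨x, hx, hxn⟩ := Finset.not_subset.1 hn
    have hxB := Finset.mem_powerset.1 hs3 hx
    refine ⟨x, hx, Finset.mem_filter.2 ⟨hxB, fun g hg => ?_⟩⟩
    have h1 := hs5 ((mem_rightHull G).2 ⟨x, hx, Or.inr ⟨g, hg, rfl⟩⟩)
    rw [mem_finBall] at h1 hxn hxB
    omega
  have h1 := (Finset.card_le_card hPQ).trans
    (card_filter_meet_le (cayleyGraph G) (finBall G (n + 1)) (deadBall G (n + 1)) hS)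
  rw [Finset.card_sdiff_of_subset hQP] at h1
  rw [← Nat.cast_sub (Finset.card_le_card hQP)]
  exact_mod_cast h1

theorem tendsto_deadBall (hd : DeadElementsNegligible G) :
    Tendsto (fun n => ((deadBall G n).card : ℝ) / (finBall G n).card) atTop (𝓝 0) := by
  refine Tendsto.congr (fun n => ?_) hd
  have h1 : ball G n ∩ deadElements G = (deadBall G n : Set Γ) := by
    rw [deadBall, Finset.coe_filter, ← coe_finBall]
    rfl
  rw [h1, Set.ncard_coe_finset, ← coe_finBall, Set.ncard_coe_finset]

/-- The count in the smaller ball is normalized by the larger one; up to the proportion of dead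
elements it is `innerCount`, which is continuous. -/
theorem tendsto_subCount (hd : DeadElementsNegligible G) {n : ℕ → ℕ}
    (hn : Tendsto n atTop atTop)
    {ω : ConfSeries (CayleyColor G) (Nat.card (CayleyColor G))}
    (h : Tendsto (fun m => freeEnergy G (n m)) atTop (𝓝 ω))
    {S : Conf (CayleyColor G) (Nat.card (CayleyColor G))} (hS : S.IsConnected) :
    Tendsto (fun m => (subCount (cayleyGraph G) (finBall G (n m - 1)) S : ℝ) /
      (finBall G (n m)).card) atTop (𝓝 (innerCount G ω S)) := by
  have h1 : Tendsto (fun m => innerCount G (freeEnergy G (n m)) S) atTop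
      (𝓝 (innerCount G ω S)) :=
    tendsto_finsetSum _ fun U _ => (tendsto_pi_nhds.1 h U).mul_const _
  have h2 : Tendsto (fun m => innerCount G (freeEnergy G (n m)) S -
      (subCount (cayleyGraph G) (finBall G (n m - 1)) S : ℝ) / (finBall G (n m)).card)
      atTop (𝓝 0) := by
    have h3 := ((tendsto_deadBall G hd).comp hn).mul_const
      ((2 ^ (Nat.card (CayleyColor G) + 1) ^ S.size : ℕ) : ℝ)
    rw [zero_mul] at h3
    refine squeeze_zero_norm' ?_ h3
    -- Truncated subtraction in n m - 1 is harmless once n m ≥ 1.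
    filter_upwards [hn.eventually_ge_atTop 1] with m hm
    obtain ⟨k, hk⟩ := Nat.exists_eq_add_of_le' hm
    rw [Function.comp_apply, hk, Real.norm_eq_abs]
    exact abs_innerCount_sub_le G k hS
  have h4 := h1.sub h2
  simpa using h4

/-- The configuration with one vertex. -/
def point : Conf (CayleyColor G) (Nat.card (CayleyColor G)) := (cayleyGraph G).subconf {1}

theorem subconf_eq_point_iff {s : Finset Γ} :
    (cayleyGraph G).subconf s = point G ↔ s.card = 1 := by
  constructor
  · intro h
    have h1 := congrArg Conf.size h
    rwa [point, size_subconf, size_subconf, Finset.card_singleton] at h1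
  · intro h
    obtain ⟨x, rfl⟩ := Finset.card_eq_one.1 h
    have e : ∀ y : Γ, Unique ((({y} : Finset Γ) : Set Γ) : Type u) := fun y =>
      ⟨⟨⟨y, by simp⟩⟩, fun z => Subtype.ext (by simpa using z.2)⟩
    have := e x
    have := e 1
    refine conf_eq_conf_iff.2 ⟨Equiv.ofUnique _ _, fun a b => ?_⟩
    rw [Subsingleton.elim a b, color_self, color_self]

theorem isConnected_point : (point G).IsConnected := by
  rw [point, isConnected_subconf]
  have : Subsingleton ((({1} : Finset Γ) : Set Γ) : Type u) :=
    ⟨fun a b => Subtype.ext (by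
      have ha := a.2
      have hb := b.2
      simp only [Finset.coe_singleton, Set.mem_singleton_iff] at ha hb
      rw [ha, hb])⟩
  have : Nonempty ((({1} : Finset Γ) : Set Γ) : Type u) := ⟨⟨1, by simp⟩⟩
  exact SimpleGraph.Connected.mk SimpleGraph.Preconnected.of_subsingleton

theorem subCount_point (w : Finset Γ) : subCount (cayleyGraph G) w (point G) = w.card := by
  unfold subCount
  simp only [subconf_eq_point_iff]
  rw [← Finset.powersetCard_eq_filter, Finset.card_powersetCard, Nat.choose_one_right]

/-- The limit of the free energies of the preceding balls. -/
def shiftLimit (ω : ConfSeries (CayleyColor G) (Nat.card (CayleyColor G))) :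
    ConfSeries (CayleyColor G) (Nat.card (CayleyColor G)) := fun S =>
  ∑ U ∈ connectedConfs (CayleyColor G) (Nat.card (CayleyColor G)) S.size,
    innerCount G ω U / innerCount G ω (point G) * lieCoeff S U

theorem tendsto_shiftLimit (hd : DeadElementsNegligible G) {n : ℕ → ℕ}
    (hn : Tendsto n atTop atTop)
    {ω : ConfSeries (CayleyColor G) (Nat.card (CayleyColor G))}
    (h : Tendsto (fun m => freeEnergy G (n m)) atTop (𝓝 ω)) :
    Tendsto (fun m => freeEnergy G (n m - 1)) atTop (𝓝 (shiftLimit G ω)) := by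
  have hp := tendsto_subCount G hd hn h (isConnected_point G)
  simp only [subCount_point] at hp
  have hpos : innerCount G ω (point G) ≠ 0 := by
    -- A ball is at most #G + 1 times as large as the preceding one, which keeps the limit of
    -- #Γ_{n-1}/#Γ_n away from zero.
    have h1 : ((G.carrier.card + 1 : ℕ) : ℝ)⁻¹ ≤ innerCount G ω (point G) := by
      refine ge_of_tendsto hp ?_
      filter_upwards [hn.eventually_ge_atTop 1] with m hm
      obtain ⟨k, hk⟩ := Nat.exists_eq_add_of_le' hm
      rw [hk, Nat.add_sub_cancel]
      have h2 : (0 : ℝ) < (finBall G (k + 1)).card := by exact_mod_cast card_finBall_pos G (k + 1)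
      rw [le_div_iff₀ h2, inv_mul_le_iff₀ (by positivity), mul_comm]
      exact_mod_cast card_finBall_succ_le G k
    exact (lt_of_lt_of_le (by positivity) h1).ne'
  rw [tendsto_pi_nhds]
  intro S
  -- Numerator and denominator are both divided by the size of the larger ball, so that each has a
  -- known limit.
  have h3 : ∀ m, freeEnergy G (n m - 1) S =
      ∑ U ∈ connectedConfs (CayleyColor G) (Nat.card (CayleyColor G)) S.size,
        ((subCount (cayleyGraph G) (finBall G (n m - 1)) U : ℝ) / (finBall G (n m)).card) /
          ((finBall G (n m - 1)).card / (finBall G (n m)).card) * lieCoeff S U := by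
    intro m
    rw [freeEnergy_eq_sum]
    refine Finset.sum_congr rfl fun U hU => ?_
    have h4 : ((finBall G (n m)).card : ℝ) ≠ 0 := by
      exact_mod_cast (card_finBall_pos G (n m)).ne'
    rw [freeEnergy_of_isConnected G _ (mem_connectedConfs.1 hU).2, div_div_div_cancel_right₀ h4]
  simp only [h3]
  refine tendsto_finsetSum _ fun U hU => Tendsto.mul_const _ (Tendsto.div ?_ hp hpos)
  exact tendsto_subCount G hd hn h (mem_connectedConfs.1 hU).2

/-- Every point of Ω is the limit along some strictly increasing sequence. This puts `shiftLimit`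
back into Ω, and uniqueness of limits leaves no other choice for τ. -/
theorem exists_unique_isShiftAction [Infinite Γ] (hd : DeadElementsNegligible G) :
    ∃! τ : Omega G → Omega G, IsShiftAction G τ := by
  have hseq : ∀ ω : Omega G, ∃ n : ℕ → ℕ, StrictMono n ∧
      Tendsto (fun m => freeEnergy G (n m)) atTop (𝓝 ω.1) := fun ω =>
    MapClusterPt.tendsto_subseq ((mem_Omega_iff G ω.1).1 ω.2)
  have hmem : ∀ ω : Omega G, shiftLimit G ω.1 ∈ Omega G := by
    intro ω
    obtain ⟨n, hn, h⟩ := hseq ω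
    have h1 := tendsto_shiftLimit G hd hn.tendsto_atTop h
    have h2 : Tendsto (fun m => n m - 1) atTop atTop :=
      (tendsto_sub_atTop_nat 1).comp hn.tendsto_atTop
    rw [mem_Omega_iff]
    exact MapClusterPt.of_comp h2 h1.mapClusterPt
  refine ⟨fun ω => ⟨shiftLimit G ω.1, hmem ω⟩, fun ω n hn h =>
    tendsto_shiftLimit G hd hn.tendsto_atTop h, fun τ hτ => ?_⟩
  funext ω
  obtain ⟨n, hn, h⟩ := hseq ω
  exact Subtype.ext (tendsto_nhds_unique (hτ ω n hn h)
    (tendsto_shiftLimit G hd hn.tendsto_atTop h))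

end Shift

end CayleyLimit

end

theorem mainTheorem5 {Γ : Type*} [CancelMonoid Γ] [Infinite Γ] (G : CayleyLimit.GenSystem Γ)
    (hΓ : CayleyLimit.EmbedsInGroup Γ) (hfin : (CayleyLimit.Omega G).Finite) :
    (∀ τ : CayleyLimit.Omega G → CayleyLimit.Omega G, CayleyLimit.IsShiftAction G τ →
      ∃ h : ℕ, 0 < h ∧
        CayleyLimit.IsFiniteRationallyAccumulating (CayleyLimit.freeEnergy G)
          (CayleyLimit.Omega G) h ∧
        (∀ ω ω' : CayleyLimit.Omega G, ∃ k : ℕ, τ^[k] ω = ω') ∧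
        (∀ ω : CayleyLimit.Omega G, Function.minimalPeriod τ ω = h) ∧
        Function.Bijective τ) ∧
    (CayleyLimit.DeadElementsNegligible G →
      ∃! τ : CayleyLimit.Omega G → CayleyLimit.Omega G, CayleyLimit.IsShiftAction G τ) := by
  obtain ⟨K, hK, hmem⟩ := CayleyLimit.exists_compact_freeEnergy G
  exact ⟨fun τ hτ => CayleyLimit.finite_shift hK hmem hfin (CayleyLimit.mem_Omega_iff G) τ hτ,
    CayleyLimit.exists_unique_isShiftAction G⟩
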